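/- Let $n,m\ge 0$, $T>0$, let $f:\mathbb{R}^n\times\mathbb{R}^m\to\mathbb{R}^n$ be $\mathcal{C}^2$, let $x_0\in\mathbb{R}^n$, and let $K:[0,T]\to\mathbb{R}^{m\times n}$ be measurable and (essentially) bounded. Write $L_\infty=L_\infty([0,T];\mathbb{R}^{n+m})$ (curves are identified when equal almost everywhere), with norm $\|\cdot\|$. Let $\mathcal{T}$ be the set of bounded trajectories through $x_0$: curves $\xi=(x(\cdot),u(\cdot))\in L_\infty$ with $x$ absolutely continuous, $x(0)=x_0$ and $\dot x(t)=f(x(t),u(t))$ for almost all $t\in[0,T]$. Let $\mathcal{P}$ be the trajectory tracking projection operator, which maps $\xi=(\alpha,\mu)\in L_\infty$ to the solution $\mathcal{P}(\xi)=(x,u)\in\mathcal{T}$ of the feedback system $$\dot x=f(x,u),\quad x(0)=x_0,\qquad u=\mu+K(\alpha-x),$$ and whose domain is the set of those $\xi\in L_\infty$ for which this solution exists (with $u$ bounded) on all of $[0,T]$. For $\xi\in\mathcal{T}$, the tangent space is $T_\xi\mathcal{T}=\{\zeta : D\mathcal{P}(\xi)\cdot\zeta=\zeta\}$. Let $l:[0,T]\times\mathbb{R}^n\times\mathbb{R}^m\to\mathbb{R}$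 be such that $l(t,x,u)$ is $\mathcal{C}^2$ in $(x,u)$, and $l$ and its $(x,u)$-derivatives of order at most two are continuous in $(t,x,u)$; let $\varphi:\mathbb{R}^n\to\mathbb{R}$ be $\mathcal{C}^2$. Put $$h(x,u)=\int_0^T l(t,x(t),u(t))\,dt+\varphi(x(T)),\qquad g_0=h\circ\mathcal{P}.$$ **Theorem.** Suppose $\xi_0\in\mathcal{T}$ is such that $Dg_0(\xi_0)\cdot\zeta=0$ for all $\zeta\in L_\infty$, and that there is a $c_0>0$ such that $$D^2g_0(\xi_0)\cdot(\zeta,\zeta)\ \ge\ c_0\,\|\zeta\|_{L_2}^2\qquad\text{for all }\zeta\in T_{\xi_0}\mathcal{T},$$ where $D$ and $D^2$ denote Fréchet derivatives on $L_\infty$ and $\|(\beta,\nu)\|_{L_2}^2=\int_0^T(\|\beta(t)\|^2+\|\nu(t)\|^2)\,dt$. Then $\xi_0$ is an isolated local minimizer: there is a $\delta>0$ such that $$g_0(\xi_0)<g_0(\xi)\qquad\text{for all }\xi\in\mathcal{T}\text{ with }\|\xi-\xi_0\|<\delta,\ \xi\ne\xi_0.$$ -/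

import Mathlib

open MeasureTheory Set
open scoped ENNReal

noncomputable section

namespace TrajOpt

/-- The state space `ℝⁿ` and the input space `ℝᵐ`, with their Euclidean norms. -/
abbrev Vec (n : ℕ) : Type := EuclideanSpace ℝ (Fin n)

/-- The time interval `[0, T]`; it carries Lebesgue measure as `volume`. -/
abbrev Time (T : ℝ) : Type := Icc (0 : ℝ) T

instance instMeasureSpaceTime (T : ℝ) : MeasureSpace (Time T) := Measure.Subtype.measureSpace

instance instIsFiniteMeasureTime (T : ℝ) : IsFiniteMeasure (volume : Measure (Time T)) := by
  refine ⟨?_⟩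
  rw [Measure.Subtype.volume_univ measurableSet_Icc.nullMeasurableSet, Real.volume_Icc]
  exact ENNReal.ofReal_lt_top

/-- The final time, as a point of `[0, T]`. -/
def finalTime {T : ℝ} (hT : 0 < T) : Time T := ⟨T, right_mem_Icc.2 hT.le⟩

/-- The Banach space `L_∞[0,T]` of (essentially) bounded measurable state-input curves
`ξ = (α, μ)`, up to almost everywhere equality. -/
abbrev Curve (n m : ℕ) (T : ℝ) : Type :=
  Lp (Vec n) ∞ (volume : Measure (Time T)) × Lp (Vec m) ∞ (volume : Measure (Time T))

/-- The state-input curves `(x, u)` with continuous state part and bounded measurable input part;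
the norm is the `L_∞` norm. -/
abbrev ContCurve (n m : ℕ) (T : ℝ) : Type :=
  C(Time T, Vec n) × Lp (Vec m) ∞ (volume : Measure (Time T))

/-- The inclusion of the curves with continuous state into `L_∞[0,T]`. -/
def toCurve {n m : ℕ} {T : ℝ} : ContCurve n m T →L[ℝ] Curve n m T :=
  (ContinuousMap.toLp ∞ (volume : Measure (Time T)) ℝ).prodMap (ContinuousLinearMap.id ℝ _)

/-- `‖ζ‖²` in `L_2[0,T]`. -/
def normSqL2 {n m : ℕ} {T : ℝ} (ζ : ContCurve n m T) : ℝ :=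
  ∫ t : Time T, (‖ζ.1 t‖ ^ 2 + ‖ζ.2 t‖ ^ 2)

/-- `(x, u)` satisfies `x' = f (x, u)` almost everywhere on `[0, T]` and `x 0 = x₀`
(a Carathéodory solution, in integrated form). -/
def SolvesDynamics {n m : ℕ} {T : ℝ} (f : Vec n × Vec m → Vec n) (x₀ : Vec n)
    (η : ContCurve n m T) : Prop :=
  ∀ t : Time T, η.1 t = x₀ + ∫ s in Iic t, f (η.1 s, η.2 s)

/-- The set of bounded state-input trajectories of `x' = f (x, u)` through `x₀`. -/
def trajectories {n m : ℕ} (T : ℝ) (f : Vec n × Vec m → Vec n) (x₀ : Vec n) :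
    Set (ContCurve n m T) :=
  {η | SolvesDynamics f x₀ η}

/-- `η = (x, u)` is the response of the feedback system
`x' = f (x, u)`, `x 0 = x₀`, `u = μ + K (α - x)` to the curve `ξ = (α, μ)`. -/
def IsFeedbackResponse {n m : ℕ} {T : ℝ} (f : Vec n × Vec m → Vec n) (x₀ : Vec n)
    (K : Time T → Vec n →L[ℝ] Vec m) (ξ : Curve n m T) (η : ContCurve n m T) : Prop :=
  SolvesDynamics f x₀ η ∧ ∀ᵐ t : Time T, η.2 t = ξ.2 t + K t (ξ.1 t - η.1 t)

open Classical in
/-- The trajectory tracking projection operator `ξ = (α, μ) ↦ η = (x, u)`. Its domain consists of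
the curves whose feedback response exists on all of `[0, T]` (the response is then unique when `f`
is locally Lipschitz and `K` is bounded); outside it the value is set to `0`. -/
def projOp {n m : ℕ} {T : ℝ} (f : Vec n × Vec m → Vec n) (x₀ : Vec n)
    (K : Time T → Vec n →L[ℝ] Vec m) (ξ : Curve n m T) : ContCurve n m T :=
  if h : ∃ η, IsFeedbackResponse f x₀ K ξ η then h.choose else 0

/-- The tangent space at `ξ` to the set of trajectories: the curves `ζ` with `ζ = DP(ξ)·ζ`, where
`P` is the projection operator. -/
def tangentSpace {n m : ℕ} {T : ℝ} (f : Vec n × Vec m → Vec n) (x₀ : Vec n)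
    (K : Time T → Vec n →L[ℝ] Vec m) (ξ : ContCurve n m T) : Set (ContCurve n m T) :=
  {ζ | fderiv ℝ (projOp f x₀ K) (toCurve ξ) (toCurve ζ) = ζ}

/-- The running cost `l t (x, u)` is `C²` in `(x, u)`, and it and its `(x, u)`-derivatives of order
at most two are continuous in `(t, x, u)`. -/
def IsRunningCost {n m : ℕ} {T : ℝ} (l : Time T → Vec n × Vec m → ℝ) : Prop :=
  (∀ t, ContDiff ℝ 2 (l t)) ∧
    ∀ k : ℕ, k ≤ 2 →
      Continuous fun p : Time T × (Vec n × Vec m) => iteratedFDeriv ℝ k (l p.1) p.2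

/-- The cost functional `h (x, u) = ∫₀ᵀ l(t, x(t), u(t)) dt + φ(x(T))`. -/
def cost {n m : ℕ} {T : ℝ} (hT : 0 < T) (l : Time T → Vec n × Vec m → ℝ) (φ : Vec n → ℝ)
    (η : ContCurve n m T) : ℝ :=
  (∫ t : Time T, l t (η.1 t, η.2 t)) + φ (η.1 (finalTime hT))

/-- The functional `g₀ = h ∘ P` on `L_∞[0,T]`. -/
def reducedCost {n m : ℕ} {T : ℝ} (hT : 0 < T) (f : Vec n × Vec m → Vec n) (x₀ : Vec n)
    (K : Time T → Vec n →L[ℝ] Vec m) (l : Time T → Vec n × Vec m → ℝ) (φ : Vec n → ℝ)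
    (ξ : Curve n m T) : ℝ :=
  cost hT l φ (projOp f x₀ K ξ)

end TrajOpt

end

open TrajOpt

/-! The difficulty is the two-norm discrepancy: the functionals are smooth only in `L_∞`, while
coercivity holds only in `L_2`. A second difficulty is that the set of trajectories is curved. A
Lagrange multiplier deals with the curvature.

Write the dynamics as `x - x₀ - ∫₀^· f(x, u) = 0` in `C([0,T])`. Its linearization at `ξ₀` has a
bounded right inverse `S`, because along the feedback law it reduces to `1 - V` with `V` a Volterra
operator (`isUnit_one_sub_volterra`). Put `lam = Dh(ξ₀) ∘ S` and let `L` be `h` minus `lam` of the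
constraint. Stationarity of `g₀` makes `Dh(ξ₀)` vanish on the kernel of the linearized constraint,
hence `DL(ξ₀) = 0` on all curves. Near `ξ₀`, `g₀ = L ∘ P` with `P` of class `C¹`
(`contDiffAt_projOp`). Since `DL(ξ₀) = 0`, `D²g₀(ξ₀) = D²L(ξ₀)(DP ·, DP ·)` without differentiating
`P` twice (`fderiv_fderiv_comp_of_critical`). So `D²L(ξ₀)` is `L_2`-coercive on the kernel.

For a nearby trajectory `ξ`, split `ζ = ξ - ξ₀` as `γ + d`, with `γ` in the kernel and `d = S` of
the linearization residual. The residual is an integrated Taylor remainder, so `d` is small relative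
to the `L_2` norm of `ζ` (`exists_energy_correction_le`). The form `D²L` is bounded by `L_2` norms
and final states, and in that sense varies continuously with the base point in `L_∞`. Thus
coercivity survives the correction `d` and the motion along the segment from `ξ₀` to `ξ`, and
Taylor's formula gives `L(ξ₀) < L(ξ)`; on trajectories `L = h`. -/

noncomputable section

open Filter Topology

set_option linter.unusedSectionVars false

namespace TrajOpt

/-! ### Essential bounds and pointwise action of operator families. -/

section Linfty

variable {α : Type*} [MeasurableSpace α] {μ : Measure α}
  {E F : Type*} [NormedAddCommGroup E] [NormedAddCommGroup F]

theorem ae_norm_le_norm_Linfty (w : Lp E ∞ μ) : ∀ᵐ t ∂μ, ‖w t‖ ≤ ‖w‖ := by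
  filter_upwards [ae_le_eLpNormEssSup (f := w) (μ := μ)] with t ht
  rw [← eLpNorm_exponent_top] at ht
  rw [Lp.norm_def, ← toReal_enorm]
  exact ENNReal.toReal_mono (Lp.eLpNorm_ne_top w) ht

theorem norm_Linfty_le [IsFiniteMeasure μ] {w : Lp E ∞ μ} {C : ℝ} (hC : 0 ≤ C)
    (h : ∀ᵐ t ∂μ, ‖w t‖ ≤ C) : ‖w‖ ≤ C := by
  simpa using Lp.norm_le_of_ae_bound hC h

variable [NormedSpace ℝ E] [NormedSpace ℝ F]

/-- The action of `L_∞` families of operators on `L_∞`. -/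
def applyL (μ : Measure α) (E F : Type*) [NormedAddCommGroup E] [NormedSpace ℝ E]
    [NormedAddCommGroup F] [NormedSpace ℝ F] :
    Lp (E →L[ℝ] F) ∞ μ →L[ℝ] Lp E ∞ μ →L[ℝ] Lp F ∞ μ :=
  (ContinuousLinearMap.id ℝ (E →L[ℝ] F)).holderL μ ∞ ∞ ∞

theorem coeFn_applyL (A : Lp (E →L[ℝ] F) ∞ μ) (w : Lp E ∞ μ) :
    applyL μ E F A w =ᵐ[μ] fun t => A t (w t) :=
  ContinuousLinearMap.coeFn_holder _ A w

end Linfty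

/-! ### Estimates uniform in time and on bounded sets. -/

section BoundsOnBalls

variable {α : Type*} [PseudoMetricSpace α] [CompactSpace α]
  {E F : Type*} [NormedAddCommGroup E] [NormedSpace ℝ E] [ProperSpace E]
  [NormedAddCommGroup F] [NormedSpace ℝ F]

theorem exists_norm_le_on_ball (g : C(α × E, F)) (R : ℝ) :
    ∃ C, 0 ≤ C ∧ ∀ t x, ‖x‖ ≤ R → ‖g (t, x)‖ ≤ C := by
  obtain ⟨C, hC⟩ := (isCompact_univ.prod (isCompact_closedBall (0 : E) R)).exists_bound_of_continuousOn
    (f := g) (by fun_prop)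
  exact ⟨max C 0, le_max_right _ _, fun t x hx =>
    (hC (t, x) ⟨mem_univ _, by simpa using hx⟩).trans (le_max_left _ _)⟩

theorem exists_dist_le_on_ball (g : C(α × E, F)) (R : ℝ) {ε : ℝ} (hε : 0 < ε) :
    ∃ δ, 0 < δ ∧ ∀ t x y, ‖x‖ ≤ R → ‖y - x‖ < δ → ‖g (t, y) - g (t, x)‖ ≤ ε := by
  -- The ball is enlarged by one and `δ` capped at one, so that `y` needs no bound of its own.
  have hu := (isCompact_univ.prod (isCompact_closedBall (0 : E) (R + 1))).uniformContinuousOn_of_continuous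
    (f := g) (by fun_prop)
  obtain ⟨δ, hδ, h⟩ := Metric.uniformContinuousOn_iff.1 hu ε hε
  refine ⟨min δ 1, by positivity, fun t x y hx hxy => ?_⟩
  have h1 : ‖y‖ ≤ R + 1 := by
    have := norm_sub_norm_le y x
    have := hxy.le.trans (min_le_right δ 1)
    linarith
  have := h (t, y) ⟨mem_univ _, by simpa using h1⟩ (t, x)
    ⟨mem_univ _, by simpa using hx.trans (by linarith)⟩
    (by simpa [Prod.dist_eq, dist_eq_norm, hδ] using hxy.trans_le (min_le_left δ 1))
  rw [dist_eq_norm] at this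
  exact this.le

theorem exists_lipschitz_on_ball (g : C(α × E, F)) (g' : C(α × E, E →L[ℝ] F))
    (hg : ∀ t x, HasFDerivAt (fun y => g (t, y)) (g' (t, x)) x) (R : ℝ) :
    ∃ L, 0 ≤ L ∧ ∀ t x y, ‖x‖ ≤ R → ‖y‖ ≤ R → ‖g (t, x) - g (t, y)‖ ≤ L * ‖x - y‖ := by
  obtain ⟨L, hL, h⟩ := exists_norm_le_on_ball g' R
  refine ⟨L, hL, fun t x y hx hy => ?_⟩
  exact (convex_closedBall (0 : E) R).norm_image_sub_le_of_norm_hasFDerivWithin_le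
    (f := fun y => g (t, y)) (f' := fun y => g' (t, y))
    (fun z _ => (hg t z).hasFDerivWithinAt) (fun z hz => h t z (by simpa using hz))
    (by simpa using hy) (by simpa using hx)

/-- Mean value inequality on `ball x δ`, where `g'` oscillates by at most `ε`. One `δ` serves all
`t` and `x`, so the estimate passes to `L_∞`. -/
theorem exists_remainder_le_on_ball (g : C(α × E, F)) (g' : C(α × E, E →L[ℝ] F))
    (hg : ∀ t x, HasFDerivAt (fun y => g (t, y)) (g' (t, x)) x) (R : ℝ) {ε : ℝ} (hε : 0 < ε) :
    ∃ δ, 0 < δ ∧ ∀ t x v, ‖x‖ ≤ R → ‖v‖ < δ →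
      ‖g (t, x + v) - g (t, x) - g' (t, x) v‖ ≤ ε * ‖v‖ := by
  obtain ⟨δ, hδ, h⟩ := exists_dist_le_on_ball g' R hε
  refine ⟨δ, hδ, fun t x v hx hv => ?_⟩
  have key := (convex_ball x δ).norm_image_sub_le_of_norm_hasFDerivWithin_le'
    (f := fun y => g (t, y)) (f' := fun y => g' (t, y)) (φ := g' (t, x)) (C := ε)
    (x := x) (y := x + v)
    (fun x _ => (hg t x).hasFDerivWithinAt)
    (fun y hy => h t _ _ hx (by simpa [dist_eq_norm] using hy))
    (Metric.mem_ball_self hδ)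
    (by simpa [dist_eq_norm] using hv)
  rwa [add_sub_cancel_left] at key

end BoundsOnBalls

/-! ### Superposition operators on `L_∞`. -/

section Nemytskii

variable {α : Type*} [PseudoMetricSpace α] [CompactSpace α] [SecondCountableTopology α]
  [MeasurableSpace α] [OpensMeasurableSpace α] {μ : Measure α} [IsFiniteMeasure μ]
  {E F : Type*} [NormedAddCommGroup E] [NormedSpace ℝ E] [ProperSpace E]
  [NormedAddCommGroup F] [NormedSpace ℝ F]

theorem memLp_nemytskii (g : C(α × E, F)) (w : Lp E ∞ μ) :
    MemLp (fun t => g (t, w t)) ∞ μ := by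
  obtain ⟨C, -, hC⟩ := exists_norm_le_on_ball g ‖w‖
  refine memLp_top_of_bound ?_ C ?_
  · exact g.continuous.comp_aestronglyMeasurable
      (aestronglyMeasurable_id.prodMk (Lp.aestronglyMeasurable w))
  · filter_upwards [ae_norm_le_norm_Linfty w] with t ht using hC t _ ht

/-- The superposition (Nemytskii) operator `w ↦ g(·, w(·))` on `L_∞`. -/
def nemytskii (g : C(α × E, F)) (w : Lp E ∞ μ) : Lp F ∞ μ :=
  (memLp_nemytskii g w).toLp

theorem coeFn_nemytskii (g : C(α × E, F)) (w : Lp E ∞ μ) :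
    nemytskii g w =ᵐ[μ] fun t => g (t, w t) :=
  MemLp.coeFn_toLp _

theorem continuous_nemytskii (g : C(α × E, F)) :
    Continuous (nemytskii g : Lp E ∞ μ → Lp F ∞ μ) := by
  refine continuous_iff_continuousAt.2 fun w => Metric.continuousAt_iff.2 fun ε hε => ?_
  -- Half of `ε`, since an almost everywhere bound yields only a non-strict inequality of norms.
  obtain ⟨δ, hδ, h⟩ := exists_dist_le_on_ball g ‖w‖ (half_pos hε)
  refine ⟨δ, hδ, fun v hv => ?_⟩
  rw [dist_eq_norm] at hv ⊢
  refine (norm_Linfty_le (half_pos hε).le ?_).trans_lt (half_lt_self hε)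
  filter_upwards [coeFn_nemytskii g w, coeFn_nemytskii g v, ae_norm_le_norm_Linfty w,
    ae_norm_le_norm_Linfty (v - w), Lp.coeFn_sub v w,
    Lp.coeFn_sub (nemytskii g v) (nemytskii g w)] with t h1 h2 h3 h4 h5 h6
  rw [h6, Pi.sub_apply, h1, h2]
  rw [h5, Pi.sub_apply] at h4
  exact h t _ _ h3 (h4.trans_lt hv)

/-- A small `L_∞` norm makes the increment small at almost every time, so the uniform pointwise
remainder estimate applies. An `L_2`-small increment would not allow this. -/
theorem hasFDerivAt_nemytskii (g : C(α × E, F)) (g' : C(α × E, E →L[ℝ] F))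
    (hg : ∀ t x, HasFDerivAt (fun y => g (t, y)) (g' (t, x)) x) (w : Lp E ∞ μ) :
    HasFDerivAt (nemytskii g) (applyL μ E F (nemytskii g' w)) w := by
  rw [hasFDerivAt_iff_isLittleO_nhds_zero, Asymptotics.isLittleO_iff]
  intro ε hε
  obtain ⟨δ, hδ, h⟩ := exists_remainder_le_on_ball g g' hg ‖w‖ hε
  filter_upwards [Metric.ball_mem_nhds 0 hδ] with v hv
  rw [mem_ball_zero_iff] at hv
  refine norm_Linfty_le (by positivity) ?_
  filter_upwards [coeFn_nemytskii g w, coeFn_nemytskii g (w + v), coeFn_nemytskii g' w,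
    coeFn_applyL (nemytskii g' w) v, ae_norm_le_norm_Linfty w,
    ae_norm_le_norm_Linfty v, Lp.coeFn_add w v,
    Lp.coeFn_sub (nemytskii g (w + v) - nemytskii g w) (applyL μ E F (nemytskii g' w) v),
    Lp.coeFn_sub (nemytskii g (w + v)) (nemytskii g w)] with t h1 h2 h3 h4 h5 h6 h7 h8 h9
  rw [h8, Pi.sub_apply, h9, Pi.sub_apply, h1, h2, h4, h3, h7, Pi.add_apply]
  exact (h t _ _ h5 (h6.trans_lt hv)).trans (by gcongr)

end Nemytskii

/-! ### Integration, Gronwall's inequality and Volterra operators. -/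

section Integration

variable {T : ℝ} {F : Type*} [NormedAddCommGroup F] [NormedSpace ℝ F]

theorem integrable_Linfty (w : Lp F ∞ (volume : Measure (Time T))) : Integrable w :=
  (Lp.memLp w).integrable le_top

theorem setIntegral_Iic_time (g : ℝ → ℝ) (t : Time T) :
    ∫ s in Iic t, g s = ∫ s in Icc (0 : ℝ) t, g s := by
  have h := (measurePreserving_subtype_coe (μa := (volume : Measure ℝ))
    (measurableSet_Icc (a := (0 : ℝ)) (b := T))).setIntegral_preimage_emb
    (MeasurableEmbedding.subtype_coe measurableSet_Icc) g (Iic (t : ℝ))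
  rw [Measure.restrict_restrict measurableSet_Iic] at h
  have h1 : Iic (t : ℝ) ∩ Icc 0 T = Icc 0 (t : ℝ) := by
    ext s; simp only [mem_inter_iff, mem_Iic, mem_Icc]
    exact ⟨fun h => ⟨h.2.1, h.1⟩, fun h => ⟨h.2, h.1, h.2.trans t.2.2⟩⟩
  rw [h1] at h
  exact h

theorem setIntegral_Iic_exp_le {c : ℝ} (hc : 0 < c) (t : Time T) :
    ∫ s in Iic t, Real.exp (c * s) ≤ Real.exp (c * t) / c := by
  rw [setIntegral_Iic_time (fun s => Real.exp (c * s)), integral_Icc_eq_integral_Ioc,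
    ← intervalIntegral.integral_of_le t.2.1, intervalIntegral.integral_comp_mul_left _ hc.ne',
    integral_exp, smul_eq_mul, div_eq_inv_mul]
  have := Real.exp_pos (c * 0)
  gcongr
  linarith

theorem measureReal_Ioc_time (s t : Time T) : (volume : Measure (Time T)).real (Ioc s t) ≤ dist s t := by
  have h := (measurePreserving_subtype_coe (μa := (volume : Measure ℝ))
    (measurableSet_Icc (a := (0 : ℝ)) (b := T))).measure_preimage
    (measurableSet_Ioc (a := (s : ℝ)) (b := t)).nullMeasurableSet
  have h1 : (volume : Measure (Time T)) (Ioc s t) ≤ ENNReal.ofReal (t - s) := by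
    rw [← Real.volume_Ioc]
    exact h.le.trans (Measure.restrict_apply_le _ _)
  refine (ENNReal.toReal_mono ENNReal.ofReal_ne_top h1).trans ?_
  rw [ENNReal.toReal_ofReal', Subtype.dist_eq, Real.dist_eq]
  exact max_le (by rw [abs_sub_comm]; exact le_abs_self _) (abs_nonneg _)

theorem continuous_primitive (w : Lp F ∞ (volume : Measure (Time T))) :
    Continuous fun t : Time T => ∫ s in Iic t, w s := by
  have key : ∀ s t : Time T, s ≤ t →
      dist (∫ r in Iic t, w r) (∫ r in Iic s, w r) ≤ ‖w‖ * dist s t := by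
    intro s t hst
    have hi := (integrable_Linfty w).integrableOn (s := Iic s)
    have hi' := (integrable_Linfty w).integrableOn (s := Ioc s t)
    rw [← Iic_union_Ioc_eq_Iic hst, setIntegral_union (Iic_disjoint_Ioc le_rfl) measurableSet_Ioc hi hi',
      dist_eq_norm, add_sub_cancel_left]
    refine (norm_setIntegral_le_of_norm_le_const_ae' (C := ‖w‖) (measure_lt_top _ _)
      ?_).trans ?_
    · filter_upwards [ae_norm_le_norm_Linfty w] with r hr _ using hr
    · gcongr
      exact measureReal_Ioc_time s t
  refine (LipschitzWith.of_dist_le_mul (K := ‖w‖₊) fun s t => ?_).continuous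
  rcases le_total s t with h | h
  · rw [dist_comm]; exact key s t h
  · rw [dist_comm s t]; exact key t s h

theorem setIntegral_norm_le (w : Lp F ∞ (volume : Measure (Time T))) (t : Time T) :
    ‖∫ s in Iic t, w s‖ ≤ ∫ s, ‖w s‖ :=
  (norm_integral_le_integral_norm _).trans
    (setIntegral_le_integral (integrable_Linfty w).norm (ae_of_all _ fun _ => norm_nonneg _))

theorem integral_norm_le (w : Lp F ∞ (volume : Measure (Time T))) :
    ∫ s, ‖w s‖ ≤ (volume : Measure (Time T)).real univ * ‖w‖ := by
  have := integral_mono_ae (integrable_Linfty w).norm (integrable_const ‖w‖)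
    (ae_norm_le_norm_Linfty w)
  simpa using this

/-- The integration operator `w ↦ ∫₀^· w` from `L_∞` to the continuous functions. -/
def primitive (T : ℝ) (F : Type*) [NormedAddCommGroup F] [NormedSpace ℝ F] :
    Lp F ∞ (volume : Measure (Time T)) →L[ℝ] C(Time T, F) :=
  LinearMap.mkContinuous
    { toFun := fun w => ⟨fun t => ∫ s in Iic t, w s, continuous_primitive w⟩
      map_add' := fun v w => by
        ext t
        simp only [ContinuousMap.coe_mk, ContinuousMap.add_apply]
        rw [← integral_add (integrable_Linfty v).integrableOn (integrable_Linfty w).integrableOn]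
        exact integral_congr_ae (ae_restrict_of_ae (Lp.coeFn_add v w))
      map_smul' := fun c w => by
        ext t
        simp only [ContinuousMap.coe_mk, ContinuousMap.smul_apply, RingHom.id_apply]
        rw [← integral_smul]
        exact integral_congr_ae (ae_restrict_of_ae (Lp.coeFn_smul c w)) }
    ((volume : Measure (Time T)).real univ)
    fun w => (ContinuousMap.norm_le _ (by positivity)).2 fun t =>
      (setIntegral_norm_le w t).trans (integral_norm_le w)

theorem primitive_apply (w : Lp F ∞ (volume : Measure (Time T))) (t : Time T) :
    primitive T F w t = ∫ s in Iic t, w s := rfl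

theorem norm_primitive_le (w : Lp F ∞ (volume : Measure (Time T))) :
    ‖primitive T F w‖ ≤ ∫ s, ‖w s‖ :=
  (ContinuousMap.norm_le _ (integral_nonneg fun _ => norm_nonneg _)).2 fun t => setIntegral_norm_le w t

/-- One Picard step in the exponentially weighted sup norm. -/
theorem norm_primitive_exp_le {w : Lp F ∞ (volume : Measure (Time T))} {C a : ℝ}
    (hC : 0 < C) (ha : 0 ≤ a) (h : ∀ᵐ s : Time T, ‖w s‖ ≤ C * (a * Real.exp (2 * C * s)))
    (t : Time T) : ‖primitive T F w t‖ ≤ a / 2 * Real.exp (2 * C * t) := by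
  have hi : Integrable fun s : Time T => Real.exp (2 * C * s) :=
    (by fun_prop : Continuous fun s : Time T => Real.exp (2 * C * s)).integrable_of_hasCompactSupport
      (HasCompactSupport.of_compactSpace _)
  calc ‖primitive T F w t‖ ≤ ∫ s in Iic t, ‖w s‖ := norm_integral_le_integral_norm _
    _ ≤ ∫ s in Iic t, (C * a) * Real.exp (2 * C * s) := by
        refine integral_mono_ae (integrable_Linfty w).norm.integrableOn
          (hi.const_mul _).integrableOn (ae_restrict_of_ae ?_)
        filter_upwards [h] with s hs
        linarith
    _ = (C * a) * ∫ s in Iic t, Real.exp (2 * C * s) := integral_const_mul _ _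
    -- The weight grows at twice the rate `C`; integrating it divides by `2 * C`, which yields the
    -- contraction factor `1 / 2`.
    _ ≤ (C * a) * (Real.exp (2 * C * t) / (2 * C)) := by
        gcongr
        exact setIntegral_Iic_exp_le (by positivity) t
    _ = a / 2 * Real.exp (2 * C * t) := by field_simp

/-- A Gronwall inequality: the only solution of `z = ∫₀^· w` with `‖w‖ ≤ C ‖z‖` is zero. -/
theorem eq_zero_of_primitive {w : Lp F ∞ (volume : Measure (Time T))} {C : ℝ}
    (z : C(Time T, F)) (hz : z = primitive T F w) (h : ∀ᵐ s : Time T, ‖w s‖ ≤ C * ‖z s‖) :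
    z = 0 := by
  -- The sign of `C` is not known, while the weighted estimate needs a positive constant.
  set D := max C 1
  have hD : 0 < D := lt_of_lt_of_le one_pos (le_max_right _ _)
  have key : ∀ k : ℕ, ∀ t : Time T, ‖z t‖ ≤ ‖z‖ * (1 / 2) ^ k * Real.exp (2 * D * t) := by
    intro k
    induction k with
    | zero =>
      intro t
      have h1 : 1 ≤ Real.exp (2 * D * t) := Real.one_le_exp (mul_nonneg (by positivity) t.2.1)
      have h2 := z.norm_coe_le_norm t
      have := norm_nonneg z
      simp only [pow_zero, mul_one]
      nlinarith
    | succ k ih =>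
      intro t
      have := norm_primitive_exp_le (w := w) hD (a := ‖z‖ * (1 / 2) ^ k) (by positivity)
        (by
          filter_upwards [h] with s hs
          calc ‖w s‖ ≤ C * ‖z s‖ := hs
            _ ≤ D * ‖z s‖ := by gcongr; exact le_max_left _ _
            _ ≤ _ := by gcongr; exact ih s) t
      rw [← hz] at this
      refine this.trans (le_of_eq ?_)
      ring
  ext t
  have hlim : Tendsto (fun k : ℕ => ‖z‖ * (1 / 2 : ℝ) ^ k * Real.exp (2 * D * t)) atTop (𝓝 0) := by
    simpa using ((tendsto_pow_atTop_nhds_zero_of_lt_one (by norm_num : (0 : ℝ) ≤ 1 / 2)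
      (by norm_num)).const_mul ‖z‖).mul_const (Real.exp (2 * D * t))
  simpa using ge_of_tendsto' hlim fun k => key k t

/-- The Volterra operator `z ↦ ∫₀^· M z`. -/
def volterra (M : Lp (F →L[ℝ] F) ∞ (volume : Measure (Time T))) :
    C(Time T, F) →L[ℝ] C(Time T, F) :=
  primitive T F ∘L applyL volume F F M ∘L ContinuousMap.toLp ∞ volume ℝ

/-- In the weighted sup norm each application of `volterra M` halves the bound, so some power has
operator norm below one in the ordinary norm. The factor `1 - volterra M` of `1 - volterra M ^ k`
then inherits invertibility. No smallness of `M` or `T` is needed. -/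
theorem isUnit_one_sub_volterra [CompleteSpace F]
    [SecondCountableTopologyEither (Time T) F]
    (M : Lp (F →L[ℝ] F) ∞ (volume : Measure (Time T))) :
    IsUnit (1 - volterra M) := by
  set C := ‖M‖ + 1
  have hC : 0 < C := by positivity
  have step : ∀ (k : ℕ) (z : C(Time T, F)) (t : Time T),
      ‖(volterra M ^ k) z t‖ ≤ ‖z‖ * (1 / 2) ^ k * Real.exp (2 * C * t) := by
    intro k z
    induction k with
    | zero =>
      intro t
      have h1 : 1 ≤ Real.exp (2 * C * t) := Real.one_le_exp (mul_nonneg (by positivity) t.2.1)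
      have h2 := z.norm_coe_le_norm t
      have := norm_nonneg z
      simp only [pow_zero, mul_one, one_apply_eq_self]
      nlinarith
    | succ k ih =>
      intro t
      set y := (volterra M ^ k) z
      have := norm_primitive_exp_le (w := applyL volume F F M (ContinuousMap.toLp ∞ volume ℝ y)) hC
        (a := ‖z‖ * (1 / 2) ^ k) (by positivity)
        (by
          filter_upwards [coeFn_applyL M (ContinuousMap.toLp ∞ volume ℝ y),
            ContinuousMap.coeFn_toLp (p := ∞) (𝕜 := ℝ) volume y, ae_norm_le_norm_Linfty M]
            with s h1 h2 h3
          rw [h1, h2]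
          calc ‖M s (y s)‖ ≤ ‖M s‖ * ‖y s‖ := (M s).le_opNorm _
            _ ≤ C * _ := by gcongr; exacts [h3.trans (by simp [C]), ih s]) t
      rw [pow_succ']
      refine le_trans this (le_of_eq ?_)
      ring
  have hlim : Tendsto (fun k : ℕ => (1 / 2 : ℝ) ^ k * Real.exp (2 * C * |T|)) atTop (𝓝 0) := by
    simpa using ((tendsto_pow_atTop_nhds_zero_of_lt_one (by norm_num : (0 : ℝ) ≤ 1 / 2)
      (by norm_num))).mul_const (Real.exp (2 * C * |T|))
  obtain ⟨k, hk⟩ := (hlim.eventually_lt_const (show (0 : ℝ) < 1 by norm_num)).exists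
  have hn : ‖volterra M ^ k‖ < 1 := by
    refine lt_of_le_of_lt (ContinuousLinearMap.opNorm_le_bound _ (by positivity) fun z => ?_) hk
    refine (ContinuousMap.norm_le _ (by positivity)).2 fun t => (step k z t).trans ?_
    have : Real.exp (2 * C * t) ≤ Real.exp (2 * C * |T|) := by
      gcongr
      exact t.2.2.trans (le_abs_self T)
    calc _ ≤ ‖z‖ * (1 / 2) ^ k * Real.exp (2 * C * |T|) := by gcongr
      _ = _ := by ring
  have hu : IsUnit (1 - volterra M ^ k) := by
    have := isUnit_one_sub_of_norm_lt_one (R := C(Time T, F) →L[ℝ] C(Time T, F)) hn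
    exact this
  -- A product of commuting factors is a unit only if each factor is.
  have hc : Commute (1 - volterra M) (∑ i ∈ Finset.range k, volterra M ^ i) :=
    Commute.sum_right _ _ _ fun i _ => (Commute.one_left _).sub_left ((Commute.refl _).pow_right i)
  rw [← mul_neg_geom_sum] at hu
  exact (hc.isUnit_mul_iff.1 hu).1

end Integration

/-! ### Pairs of curves as curves of pairs. -/

section Joint

variable {n m : ℕ} {T : ℝ}

/-- A pair of `L_∞` curves as an `L_∞` curve of pairs. -/
def joint : Curve n m T →L[ℝ] Lp (Vec n × Vec m) ∞ (volume : Measure (Time T)) :=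
  ((ContinuousLinearMap.inl ℝ (Vec n) (Vec m)).compLpL ∞ volume).coprod
    ((ContinuousLinearMap.inr ℝ (Vec n) (Vec m)).compLpL ∞ volume)

theorem coeFn_joint (ξ : Curve n m T) : joint ξ =ᵐ[volume] fun t => (ξ.1 t, ξ.2 t) := by
  have h : joint ξ = (ContinuousLinearMap.inl ℝ (Vec n) (Vec m)).compLp ξ.1 +
      (ContinuousLinearMap.inr ℝ (Vec n) (Vec m)).compLp ξ.2 := rfl
  filter_upwards [Lp.coeFn_add ((ContinuousLinearMap.inl ℝ (Vec n) (Vec m)).compLp ξ.1)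
    ((ContinuousLinearMap.inr ℝ (Vec n) (Vec m)).compLp ξ.2),
    (ContinuousLinearMap.inl ℝ (Vec n) (Vec m)).coeFn_compLp ξ.1,
    (ContinuousLinearMap.inr ℝ (Vec n) (Vec m)).coeFn_compLp ξ.2] with t h1 h2 h3
  rw [h, h1, Pi.add_apply, h2, h3]
  simp

theorem coeFn_toCurve_fst (η : ContCurve n m T) : (toCurve η).1 =ᵐ[volume] η.1 :=
  ContinuousMap.coeFn_toLp (p := ∞) (𝕜 := ℝ) volume η.1

/-- A state-input curve with continuous state as an `L_∞` curve of pairs. -/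
def pair : ContCurve n m T →L[ℝ] Lp (Vec n × Vec m) ∞ (volume : Measure (Time T)) :=
  joint ∘L toCurve

theorem coeFn_pair (η : ContCurve n m T) : pair η =ᵐ[volume] fun t => (η.1 t, η.2 t) := by
  filter_upwards [coeFn_joint (toCurve η), coeFn_toCurve_fst η] with t h1 h2
  change joint (toCurve η) t = _
  rw [h1, h2]
  rfl

end Joint

/-! ### The integrated vector field and its derivative. -/

section Dynamics

variable {n m : ℕ} {T : ℝ} {F : Type*} [NormedAddCommGroup F] [NormedSpace ℝ F]

/-- The operator `η ↦ ∫₀^· g(t, η(t)) dt`. -/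
def integrated (g : C(Time T × (Vec n × Vec m), F)) (η : ContCurve n m T) : C(Time T, F) :=
  primitive T F (nemytskii g (pair η))

/-- The derivative of `integrated g`, in terms of the derivative `g'` of `g`. -/
def integratedDeriv (g' : C(Time T × (Vec n × Vec m), (Vec n × Vec m) →L[ℝ] F))
    (η : ContCurve n m T) : ContCurve n m T →L[ℝ] C(Time T, F) :=
  primitive T F ∘L applyL volume _ F (nemytskii g' (pair η)) ∘L pair

theorem hasFDerivAt_integrated (g : C(Time T × (Vec n × Vec m), F))
    (g' : C(Time T × (Vec n × Vec m), (Vec n × Vec m) →L[ℝ] F))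
    (hg : ∀ t x, HasFDerivAt (fun y => g (t, y)) (g' (t, x)) x) (η : ContCurve n m T) :
    HasFDerivAt (integrated g) (integratedDeriv g' η) η :=
  (primitive T F).hasFDerivAt.comp η
    ((hasFDerivAt_nemytskii g g' hg (pair η)).comp η pair.hasFDerivAt)

theorem continuous_integratedDeriv
    (g' : C(Time T × (Vec n × Vec m), (Vec n × Vec m) →L[ℝ] F)) :
    Continuous (integratedDeriv g' : ContCurve n m T → _) :=
  continuous_const.clm_comp
    ((((applyL volume _ F).continuous.comp (continuous_nemytskii g')).comp
      pair.continuous).clm_comp continuous_const)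

theorem contDiff_one_integrated (g : C(Time T × (Vec n × Vec m), F))
    (g' : C(Time T × (Vec n × Vec m), (Vec n × Vec m) →L[ℝ] F))
    (hg : ∀ t x, HasFDerivAt (fun y => g (t, y)) (g' (t, x)) x) :
    ContDiff ℝ 1 (integrated g : ContCurve n m T → _) :=
  contDiff_one_iff_hasFDerivAt.2
    ⟨integratedDeriv g', continuous_integratedDeriv g', hasFDerivAt_integrated g g' hg⟩

end Dynamics

/-! ### The feedback law and the closed-loop linearization. -/

section Feedback

variable {n m : ℕ} {T : ℝ}

/-- The map `((α, μ), x) ↦ (x, μ + K (α - x))`. -/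
def feedback (K : Lp (Vec n →L[ℝ] Vec m) ∞ (volume : Measure (Time T))) :
    (Curve n m T × C(Time T, Vec n)) →L[ℝ] ContCurve n m T :=
  (ContinuousLinearMap.snd ℝ _ _).prod
    (ContinuousLinearMap.snd ℝ _ _ ∘L ContinuousLinearMap.fst ℝ _ _ +
      applyL volume _ _ K ∘L (ContinuousLinearMap.fst ℝ _ _ ∘L ContinuousLinearMap.fst ℝ _ _ -
        ContinuousMap.toLp ∞ volume ℝ ∘L ContinuousLinearMap.snd ℝ _ _))

variable (K : Lp (Vec n →L[ℝ] Vec m) ∞ (volume : Measure (Time T)))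

theorem feedback_fst (p : Curve n m T × C(Time T, Vec n)) : (feedback K p).1 = p.2 := rfl

theorem coeFn_feedback_snd (p : Curve n m T × C(Time T, Vec n)) :
    (feedback K p).2 =ᵐ[volume] fun t => p.1.2 t + K t (p.1.1 t - p.2 t) := by
  have h : (feedback K p).2 = p.1.2 + applyL volume _ _ K (p.1.1 - ContinuousMap.toLp ∞ volume ℝ p.2) :=
    rfl
  rw [h]
  filter_upwards [Lp.coeFn_add p.1.2 (applyL volume _ _ K (p.1.1 - ContinuousMap.toLp ∞ volume ℝ p.2)),
    coeFn_applyL K (p.1.1 - ContinuousMap.toLp ∞ volume ℝ p.2),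
    Lp.coeFn_sub p.1.1 (ContinuousMap.toLp ∞ volume ℝ p.2),
    ContinuousMap.coeFn_toLp (p := ∞) (𝕜 := ℝ) volume p.2] with t h1 h2 h3 h4
  rw [h1, Pi.add_apply, h2, h3, Pi.sub_apply, h4]

theorem eq_feedback_iff (ξ : Curve n m T) (η : ContCurve n m T) :
    η = feedback K (ξ, η.1) ↔ ∀ᵐ t : Time T, η.2 t = ξ.2 t + K t (ξ.1 t - η.1 t) := by
  rw [Prod.ext_iff]
  simp only [feedback_fst, true_and]
  rw [Lp.ext_iff]
  constructor
  · intro h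
    filter_upwards [h, coeFn_feedback_snd K (ξ, η.1)] with t h1 h2
    rw [h1, h2]
  · intro h
    filter_upwards [h, coeFn_feedback_snd K (ξ, η.1)] with t h1 h2
    rw [h1, h2]

theorem solvesDynamics_iff {f : Vec n × Vec m → Vec n} (fC : C(Time T × (Vec n × Vec m), Vec n))
    (hf : ∀ p, fC p = f p.2) (x₀ : Vec n) (η : ContCurve n m T) :
    SolvesDynamics f x₀ η ↔ η.1 = ContinuousMap.const _ x₀ + integrated fC η := by
  rw [ContinuousMap.ext_iff]
  refine forall_congr' fun t => ?_
  rw [ContinuousMap.add_apply, ContinuousMap.const_apply, integrated, primitive_apply]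
  have : ∫ s in Iic t, nemytskii fC (pair η) s = ∫ s in Iic t, f (η.1 s, η.2 s) := by
    refine integral_congr_ae (ae_restrict_of_ae ?_)
    filter_upwards [coeFn_nemytskii fC (pair η), coeFn_pair η] with s h1 h2
    rw [h1, hf, h2]
  rw [this]

theorem isFeedbackResponse_iff {f : Vec n × Vec m → Vec n} (fC : C(Time T × (Vec n × Vec m), Vec n))
    (hf : ∀ p, fC p = f p.2) (x₀ : Vec n) {K : Time T → Vec n →L[ℝ] Vec m} (hK : MemLp K ∞ volume)
    (ξ : Curve n m T) (η : ContCurve n m T) :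
    IsFeedbackResponse f x₀ K ξ η ↔
      η.1 = ContinuousMap.const _ x₀ + integrated fC η ∧ η = feedback (hK.toLp K) (ξ, η.1) := by
  rw [IsFeedbackResponse, solvesDynamics_iff fC hf, eq_feedback_iff]
  refine and_congr_right fun _ => ?_
  have h := hK.coeFn_toLp
  constructor
  · intro h1
    filter_upwards [h, h1] with t h2 h3
    rw [h2, h3]
  · intro h1
    filter_upwards [h, h1] with t h2 h3
    rw [← h2, h3]

theorem norm_feedback_zero_le (z : C(Time T, Vec n)) :
    ∀ᵐ t : Time T, ‖pair (feedback K (0, z)) t‖ ≤ (1 + ‖K‖) * ‖z t‖ := by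
  filter_upwards [coeFn_pair (feedback K (0, z)), coeFn_feedback_snd K (0, z),
    ae_norm_le_norm_Linfty K, Lp.coeFn_zero (Vec n) ∞ (volume : Measure (Time T)),
    Lp.coeFn_zero (Vec m) ∞ (volume : Measure (Time T))] with t h1 h2 h3 h4 h5
  rw [h1, h2, feedback_fst]
  simp only [Prod.fst_zero, Prod.snd_zero, h4, h5, Pi.zero_apply, zero_add, zero_sub, map_neg]
  have h6 := (K t).le_of_opNorm_le h3 (z t)
  have := norm_nonneg (z t)
  have := norm_nonneg K
  refine max_le ?_ ?_
  · simp only; nlinarith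
  · simp only [norm_neg]; nlinarith

/-- Two solutions of the dynamics whose difference is generated by the feedback law agree. -/
theorem eq_of_integrated (g : C(Time T × (Vec n × Vec m), Vec n))
    (g' : C(Time T × (Vec n × Vec m), (Vec n × Vec m) →L[ℝ] Vec n))
    (hg : ∀ t x, HasFDerivAt (fun y => g (t, y)) (g' (t, x)) x) {η η' : ContCurve n m T}
    (c : C(Time T, Vec n)) (ξ : Curve n m T)
    (h1 : η.1 = c + integrated g η) (h1' : η'.1 = c + integrated g η')
    (h2 : η = feedback K (ξ, η.1)) (h2' : η' = feedback K (ξ, η'.1)) : η = η' := by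
  -- The feedback law is linear, so the common input `ξ` cancels and the state difference alone
  -- determines the whole difference.
  have hd : η - η' = feedback K (0, η.1 - η'.1) := by
    conv_lhs => rw [h2, h2']
    rw [← map_sub]
    simp
  -- A local Lipschitz constant suffices: both curves are essentially bounded.
  obtain ⟨L, hL, hlip⟩ := exists_lipschitz_on_ball g g' hg (max ‖pair η‖ ‖pair η'‖)
  have hz : η.1 - η'.1 = 0 := by
    refine eq_zero_of_primitive (w := nemytskii g (pair η) - nemytskii g (pair η'))
      (C := L * (1 + ‖K‖)) _ ?_ ?_
    · rw [map_sub]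
      conv_lhs => rw [h1, h1']
      simp [integrated]
    · have hb := norm_feedback_zero_le K (η.1 - η'.1)
      rw [← hd, map_sub] at hb
      filter_upwards [hb, coeFn_nemytskii g (pair η), coeFn_nemytskii g (pair η'),
        Lp.coeFn_sub (nemytskii g (pair η)) (nemytskii g (pair η')),
        Lp.coeFn_sub (pair η) (pair η'), ae_norm_le_norm_Linfty (pair η),
        ae_norm_le_norm_Linfty (pair η')] with t h3 h4 h5 h6 h7 h8 h9
      rw [h6, Pi.sub_apply, h4, h5, mul_assoc]
      rw [h7, Pi.sub_apply] at h3
      refine (hlip t _ _ (h8.trans (le_max_left _ _)) (h9.trans (le_max_right _ _))).trans ?_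
      gcongr
  rw [hz] at hd
  rw [← sub_eq_zero, hd]
  exact map_zero _

/-- The closed-loop linearization `t ↦ A t ∘ (id, -K t)`. -/
def closedLoop (A : Lp ((Vec n × Vec m) →L[ℝ] Vec n) ∞ (volume : Measure (Time T))) :
    Lp (Vec n →L[ℝ] Vec n) ∞ (volume : Measure (Time T)) :=
  (ContinuousLinearMap.compL ℝ (Vec n) (Vec n × Vec m) (Vec n)).holder ∞ A
    ((memLp_const (ContinuousLinearMap.inl ℝ (Vec n) (Vec m))).toLp -
      ((ContinuousLinearMap.compL ℝ (Vec n) (Vec m) (Vec n × Vec m))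
        (ContinuousLinearMap.inr ℝ (Vec n) (Vec m))).compLp K)

theorem applyL_closedLoop (A : Lp ((Vec n × Vec m) →L[ℝ] Vec n) ∞ (volume : Measure (Time T)))
    (z : C(Time T, Vec n)) :
    applyL volume _ _ (closedLoop K A) (ContinuousMap.toLp ∞ volume ℝ z) =
      applyL volume _ _ A (pair (feedback K (0, z))) := by
  rw [Lp.ext_iff]
  set P := (memLp_const (ContinuousLinearMap.inl ℝ (Vec n) (Vec m)) (p := ∞)
    (μ := (volume : Measure (Time T)))).toLp
  set Q := ((ContinuousLinearMap.compL ℝ (Vec n) (Vec m) (Vec n × Vec m))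
        (ContinuousLinearMap.inr ℝ (Vec n) (Vec m))).compLp K
  filter_upwards [coeFn_applyL (closedLoop K A) (ContinuousMap.toLp ∞ volume ℝ z),
    coeFn_applyL A (pair (feedback K (0, z))),
    coeFn_pair (feedback K (0, z)), coeFn_feedback_snd K (0, z),
    ContinuousMap.coeFn_toLp (p := ∞) (𝕜 := ℝ) volume z,
    ContinuousLinearMap.coeFn_holder (r := ∞)
      (ContinuousLinearMap.compL ℝ (Vec n) (Vec n × Vec m) (Vec n)) A (P - Q),
    Lp.coeFn_sub P Q, (memLp_const (ContinuousLinearMap.inl ℝ (Vec n) (Vec m)) (p := ∞)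
    (μ := (volume : Measure (Time T)))).coeFn_toLp,
    ((ContinuousLinearMap.compL ℝ (Vec n) (Vec m) (Vec n × Vec m))
        (ContinuousLinearMap.inr ℝ (Vec n) (Vec m))).coeFn_compLp K,
    Lp.coeFn_zero (Vec n) ∞ (volume : Measure (Time T)),
    Lp.coeFn_zero (Vec m) ∞ (volume : Measure (Time T))]
    with t h1 h2 h3 h4 h5 h6 h7 h8 h9 h10 h11
  have h6' : closedLoop K A t = _ := h6
  rw [h1, h2, h3, h4, h5, h6', h7, Pi.sub_apply, h8, h9, feedback_fst]
  simp only [Prod.fst_zero, Prod.snd_zero, h10, h11, Pi.zero_apply, zero_add, zero_sub, map_neg]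
  simp only [ContinuousLinearMap.compL_apply, ContinuousLinearMap.comp_apply,
    sub_apply, ContinuousLinearMap.inl_apply, ContinuousLinearMap.inr_apply]
  simp

/-- Substituting `u = -K z` eliminates the input, so the linearized dynamics becomes a Volterra
equation in the state alone. -/
theorem integratedDeriv_feedback (g' : C(Time T × (Vec n × Vec m), (Vec n × Vec m) →L[ℝ] Vec n))
    (η : ContCurve n m T) (z : C(Time T, Vec n)) :
    integratedDeriv g' η (feedback K (0, z)) =
      volterra (closedLoop K (nemytskii g' (pair η))) z :=
  congrArg (primitive T (Vec n)) (applyL_closedLoop K _ z).symm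

/-- The linearization of the dynamic constraint is onto, with a bounded right inverse whose values
obey the feedback law. -/
theorem exists_rightInverse
    (K : Lp (Vec n →L[ℝ] Vec m) ∞ (volume : Measure (Time T)))
    (g' : C(Time T × (Vec n × Vec m), (Vec n × Vec m) →L[ℝ] Vec n))
    (η : ContCurve n m T) :
    ∃ S : C(Time T, Vec n) →L[ℝ] ContCurve n m T,
      ∀ w, (S w).1 - integratedDeriv g' η (S w) = w := by
  obtain ⟨u, hu⟩ := isUnit_one_sub_volterra (closedLoop K (nemytskii g' (pair η)))
  -- `S w` has state `z = (1 - V)⁻¹ w`, with `V` the closed-loop Volterra operator, and input `-K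
  -- z`.
  refine ⟨feedback K ∘L ContinuousLinearMap.inr ℝ _ _ ∘L (u⁻¹).val, fun w => ?_⟩
  have h := congrArg (fun L => L w) u.mul_inv
  simp only [hu] at h
  simp only [ContinuousLinearMap.comp_apply, ContinuousLinearMap.inr_apply]
  rw [integratedDeriv_feedback, feedback_fst]
  exact h

end Feedback

/-! ### The projection operator: uniqueness, smoothness, tangent vectors. -/

section Projection

variable {n m : ℕ} {T : ℝ} {f : Vec n × Vec m → Vec n}
  {g : C(Time T × (Vec n × Vec m), Vec n)}
  {g' : C(Time T × (Vec n × Vec m), (Vec n × Vec m) →L[ℝ] Vec n)}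
  {K : Time T → Vec n →L[ℝ] Vec m} {x₀ : Vec n}

/-- Uniqueness of the feedback response makes the choice in `projOp` immaterial. -/
theorem projOp_eq (hfg : ∀ p, g p = f p.2)
    (hg : ∀ t x, HasFDerivAt (fun y => g (t, y)) (g' (t, x)) x) (hK : MemLp K ∞ volume)
    {ξ : Curve n m T} {η : ContCurve n m T} (h : IsFeedbackResponse f x₀ K ξ η) :
    projOp f x₀ K ξ = η := by
  have hex : ∃ η, IsFeedbackResponse f x₀ K ξ η := ⟨η, h⟩
  rw [projOp, dif_pos hex]
  have h1 := (isFeedbackResponse_iff g hfg x₀ hK ξ _).1 hex.choose_spec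
  have h2 := (isFeedbackResponse_iff g hfg x₀ hK ξ η).1 h
  exact eq_of_integrated _ g g' hg _ ξ h1.1 h2.1 h1.2 h2.2

/-- On a trajectory the tracking error vanishes, so the feedback term is zero whatever `K` is; hence
`P` fixes trajectories. -/
theorem isFeedbackResponse_toCurve {η : ContCurve n m T} (h : SolvesDynamics f x₀ η) :
    IsFeedbackResponse f x₀ K (toCurve η) η := by
  refine ⟨h, ?_⟩
  filter_upwards [coeFn_toCurve_fst η] with t ht
  rw [ht, sub_self, map_zero, add_zero]
  rfl

/-- Implicit function theorem for `x - x₀ - ∫₀^· f(x, μ + K(α - x)) = 0`: the partial derivative in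
`x` is one minus a Volterra operator. It also gives existence of the response near a trajectory, so
the default value of `projOp` does not occur there. -/
theorem contDiffAt_projOp (hfg : ∀ p, g p = f p.2)
    (hg : ∀ t x, HasFDerivAt (fun y => g (t, y)) (g' (t, x)) x) (hK : MemLp K ∞ volume)
    {η : ContCurve n m T} (hη : SolvesDynamics f x₀ η) :
    ContDiffAt ℝ 1 (projOp f x₀ K) (toCurve η) ∧
      ∀ᶠ ξ in 𝓝 (toCurve η), IsFeedbackResponse f x₀ K ξ (projOp f x₀ K ξ) := by
  set k := hK.toLp K
  have hr := (isFeedbackResponse_iff g hfg x₀ hK _ η).1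
    (isFeedbackResponse_toCurve (K := K) hη)
  let Ψ : Curve n m T × C(Time T, Vec n) → C(Time T, Vec n) := fun p =>
    p.2 - (ContinuousMap.const _ x₀ + integrated g (feedback k p))
  have hΨ1 : ContDiff ℝ 1 Ψ := contDiff_snd.sub
    (contDiff_const.add ((contDiff_one_integrated g g' hg).comp (feedback k).contDiff))
  have hΨ : ContDiffAt ℝ 1 Ψ (toCurve η, η.1) := hΨ1.contDiffAt
  have hfd : HasFDerivAt Ψ (ContinuousLinearMap.snd ℝ _ _ - integratedDeriv g' η ∘L feedback k)
      (toCurve η, η.1) := by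
    have h1 : HasFDerivAt (integrated g) (integratedDeriv g' η) (feedback k (toCurve η, η.1)) := by
      rw [← hr.2]; exact hasFDerivAt_integrated g g' hg η
    exact hasFDerivAt_snd.sub ((h1.comp _ (feedback k).hasFDerivAt).const_add _)
  have hinr : fderiv ℝ Ψ (toCurve η, η.1) ∘L ContinuousLinearMap.inr ℝ _ _ =
      1 - volterra (closedLoop k (nemytskii g' (pair η))) := by
    rw [hfd.fderiv]
    ext1 z
    have := integratedDeriv_feedback k g' η z
    simp only [ContinuousLinearMap.comp_apply, ContinuousLinearMap.inr_apply,
      sub_apply, ContinuousLinearMap.coe_snd', this, one_apply_eq_self]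
  have hinv : (fderiv ℝ Ψ (toCurve η, η.1) ∘L ContinuousLinearMap.inr ℝ _ _).IsInvertible := by
    rw [hinr]
    obtain ⟨u, hu⟩ := isUnit_one_sub_volterra (closedLoop k (nemytskii g' (pair η)))
    exact ⟨ContinuousLinearEquiv.unitsEquiv ℝ _ u, hu⟩
  set ψ := hΨ.implicitFunction one_ne_zero hinv
  have hψ : ContDiffAt ℝ 1 ψ (toCurve η) := hΨ.contDiffAt_implicitFunction one_ne_zero hinv
  have hev : ∀ᶠ ξ in 𝓝 (toCurve η), Ψ (ξ, ψ ξ) = Ψ (toCurve η, η.1) :=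
    hΨ.eventually_apply_implicitFunction one_ne_zero hinv
  have h0 : Ψ (toCurve η, η.1) = 0 := by
    simp only [Ψ]
    rw [← hr.2, ← hr.1, sub_self]
  have hresp : ∀ᶠ ξ in 𝓝 (toCurve η), IsFeedbackResponse f x₀ K ξ (feedback k (ξ, ψ ξ)) := by
    filter_upwards [hev] with ξ hξ
    rw [h0] at hξ
    exact (isFeedbackResponse_iff g hfg x₀ hK ξ _).2 ⟨sub_eq_zero.1 hξ, rfl⟩
  have heq : projOp f x₀ K =ᶠ[𝓝 (toCurve η)] fun ξ => feedback k (ξ, ψ ξ) := by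
    filter_upwards [hresp] with ξ hξ using projOp_eq hfg hg hK hξ
  refine ⟨ContDiffAt.congr_of_eventuallyEq ?_ heq, ?_⟩
  · exact (feedback k).contDiff.contDiffAt.comp _ (contDiffAt_id.prodMk hψ)
  · filter_upwards [hresp, heq] with ξ h1 h2
    rwa [h2]

/-- Differentiate the integral equation, which `P(ξ)` satisfies for all `ξ` near the trajectory: the
values of `DP` solve the linearized dynamics. -/
theorem fderiv_projOp_fst (hfg : ∀ p, g p = f p.2)
    (hg : ∀ t x, HasFDerivAt (fun y => g (t, y)) (g' (t, x)) x) (hK : MemLp K ∞ volume)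
    {η : ContCurve n m T} (hη : SolvesDynamics f x₀ η) (ζ : Curve n m T) :
    (fderiv ℝ (projOp f x₀ K) (toCurve η) ζ).1 =
      integratedDeriv g' η (fderiv ℝ (projOp f x₀ K) (toCurve η) ζ) := by
  obtain ⟨hc, hev⟩ := contDiffAt_projOp hfg hg hK hη
  have hd := (hc.differentiableAt one_ne_zero).hasFDerivAt
  have h0 := projOp_eq hfg hg hK (isFeedbackResponse_toCurve (K := K) hη)
  have h1 : (fun ξ => (projOp f x₀ K ξ).1) =ᶠ[𝓝 (toCurve η)]
      fun ξ => ContinuousMap.const _ x₀ + integrated g (projOp f x₀ K ξ) := by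
    filter_upwards [hev] with ξ hξ using ((isFeedbackResponse_iff g hfg x₀ hK ξ _).1 hξ).1
  have h2 : HasFDerivAt (integrated g) (integratedDeriv g' η) (projOp f x₀ K (toCurve η)) := by
    rw [h0]; exact hasFDerivAt_integrated g g' hg η
  have h3 := (hd.fst).unique (((h2.comp _ hd).const_add _).congr_of_eventuallyEq h1)
  exact congrArg (fun L => L ζ) h3

theorem fderiv_projOp_eq_feedback (hfg : ∀ p, g p = f p.2)
    (hg : ∀ t x, HasFDerivAt (fun y => g (t, y)) (g' (t, x)) x) (hK : MemLp K ∞ volume)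
    {η : ContCurve n m T} (hη : SolvesDynamics f x₀ η) (ζ : Curve n m T) :
    fderiv ℝ (projOp f x₀ K) (toCurve η) ζ =
      feedback (hK.toLp K) (ζ, (fderiv ℝ (projOp f x₀ K) (toCurve η) ζ).1) := by
  obtain ⟨hc, hev⟩ := contDiffAt_projOp hfg hg hK hη
  have hd := (hc.differentiableAt one_ne_zero).hasFDerivAt
  have h1 : projOp f x₀ K =ᶠ[𝓝 (toCurve η)]
      fun ξ => feedback (hK.toLp K) (ξ, (projOp f x₀ K ξ).1) := by
    filter_upwards [hev] with ξ hξ using ((isFeedbackResponse_iff g hfg x₀ hK ξ _).1 hξ).2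
  have h2 : HasFDerivAt (fun ξ => (ξ, (projOp f x₀ K ξ).1)) _ (toCurve η) :=
    (hasFDerivAt_id (𝕜 := ℝ) (toCurve η)).prodMk hd.fst
  have h3 := hd.unique
    ((((feedback (hK.toLp K)).hasFDerivAt).comp _ h2).congr_of_eventuallyEq h1)
  exact congrArg (fun L => L ζ) h3

/-- Solutions of the linearized dynamics are tangent to the set of trajectories. -/
theorem fderiv_projOp_toCurve (hfg : ∀ p, g p = f p.2)
    (hg : ∀ t x, HasFDerivAt (fun y => g (t, y)) (g' (t, x)) x) (hK : MemLp K ∞ volume)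
    {η : ContCurve n m T} (hη : SolvesDynamics f x₀ η) {γ : ContCurve n m T}
    (hγ : γ.1 - integratedDeriv g' η γ = 0) :
    fderiv ℝ (projOp f x₀ K) (toCurve η) (toCurve γ) = γ := by
  set k := hK.toLp K
  have h1 := fderiv_projOp_fst hfg hg hK hη (toCurve γ)
  have h2 := fderiv_projOp_eq_feedback hfg hg hK hη (toCurve γ)
  set d := fderiv ℝ (projOp f x₀ K) (toCurve η) (toCurve γ)
  have hγ2 : γ = feedback k (toCurve γ, γ.1) := by
    rw [eq_feedback_iff]
    filter_upwards [coeFn_toCurve_fst γ] with t ht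
    rw [ht, sub_self, map_zero, add_zero]
    rfl
  have hd : d - γ = feedback k (0, (d - γ).1) := by
    calc d - γ = feedback k (toCurve γ, d.1) - feedback k (toCurve γ, γ.1) :=
          congrArg₂ (· - ·) h2 hγ2
      _ = feedback k (0, (d - γ).1) := by rw [← map_sub]; simp
  -- Both `d` and `γ` solve the linearized dynamics with the same feedback input; injectivity of one
  -- minus the Volterra operator forces them to agree.
  have hz : (1 - volterra (closedLoop k (nemytskii g' (pair η)))) (d - γ).1 = 0 := by
    rw [sub_apply, one_apply_eq_self, ← integratedDeriv_feedback, ← hd, map_sub, ← h1, Prod.fst_sub,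
      ← sub_eq_zero.1 hγ, sub_self]
  obtain ⟨u, hu⟩ := isUnit_one_sub_volterra (closedLoop k (nemytskii g' (pair η)))
  have h4 : (d - γ).1 = 0 := by
    have h5 := congrArg (fun L => L (d - γ).1) u.inv_mul
    simp only [hu] at h5
    change u⁻¹.val ((1 - volterra (closedLoop k (nemytskii g' (pair η)))) (d - γ).1) = (d - γ).1 at h5
    rw [← h5, hz, map_zero]
  rw [h4] at hd
  rw [← sub_eq_zero, hd]
  exact map_zero _

end Projection

/-! ### Second-order calculus at a critical point. -/

section Calculus

variable {X Y Z V W : Type*} [NormedAddCommGroup X] [NormedSpace ℝ X]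
  [NormedAddCommGroup Y] [NormedSpace ℝ Y] [NormedAddCommGroup Z] [NormedSpace ℝ Z]
  [NormedAddCommGroup V] [NormedSpace ℝ V] [NormedAddCommGroup W] [NormedSpace ℝ W]

/-- Product rule at a zero of the first factor: the second factor need only be continuous. -/
theorem hasFDerivAt_bilin_of_eq_zero (B : V →L[ℝ] W →L[ℝ] Z) {c : Y → V} {D : Y → W}
    {c' : Y →L[ℝ] V} {y : Y} (hc : HasFDerivAt c c' y) (h0 : c y = 0) (hD : ContinuousAt D y) :
    HasFDerivAt (fun z => B (c z) (D z)) (B.flip (D y) ∘L c') y := by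
  have h1 : HasFDerivAt (fun z => B.flip (D y) (c z)) (B.flip (D y) ∘L c') y :=
    (B.flip (D y)).hasFDerivAt.comp y hc
  -- This term is `O(‖z - y‖)` times `o(1)`, so it contributes no derivative.
  have h2 : HasFDerivAt (fun z => B (c z) (D z - D y)) (0 : Y →L[ℝ] Z) y := by
    rw [hasFDerivAt_iff_isLittleO]
    have hO : c =O[𝓝 y] fun z => z - y := by simpa [h0] using hc.isBigO_sub
    have ho : (fun z => D z - D y) =o[𝓝 y] fun _ => (1 : ℝ) := by
      rw [Asymptotics.isLittleO_one_iff]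
      simpa using hD.tendsto.sub_const (D y)
    have hm : (fun z => ‖c z‖ * ‖D z - D y‖) =o[𝓝 y] fun z => ‖z - y‖ * 1 :=
      hO.norm_norm.mul_isLittleO ho.norm_left
    refine (Asymptotics.IsBigO.of_bound ‖B‖ (Eventually.of_forall fun z => ?_)).trans_isLittleO
      ((by simpa using hm : (fun z => ‖c z‖ * ‖D z - D y‖) =o[𝓝 y] fun z => z - y))
    simp only [h0, map_zero, zero_apply, sub_zero]
    rw [Real.norm_of_nonneg (by positivity), ← mul_assoc]
    exact B.le_opNorm₂ _ _
  have h3 := h1.add h2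
  rw [add_zero] at h3
  refine h3.congr_of_eventuallyEq (Eventually.of_forall fun z => ?_)
  simp

/-- The second derivative of a composition at a critical point of the outer function. -/
theorem fderiv_fderiv_comp_of_critical {L : X → ℝ} {L' : X → X →L[ℝ] ℝ}
    {L'' : X →L[ℝ] X →L[ℝ] ℝ} {P : Y → X} {G : Y → ℝ} {y : Y}
    (hL : ∀ x, HasFDerivAt L (L' x) x) (hL' : HasFDerivAt L' L'' (P y)) (h0 : L' (P y) = 0)
    (hP : ContDiffAt ℝ 1 P y) (hG : G =ᶠ[𝓝 y] L ∘ P) (a b : Y) :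
    fderiv ℝ (fderiv ℝ G) y a b = L'' (fderiv ℝ P y a) (fderiv ℝ P y b) := by
  have hP' : ∀ᶠ z in 𝓝 y, DifferentiableAt ℝ P z := by
    filter_upwards [hP.eventually (by simp)] with z hz using hz.differentiableAt one_ne_zero
  have h1 : fderiv ℝ G =ᶠ[𝓝 y] fun z =>
      ContinuousLinearMap.compL ℝ Y X ℝ (L' (P z)) (fderiv ℝ P z) := by
    filter_upwards [hG.fderiv (𝕜 := ℝ), hP'] with z hz hz'
    rw [hz]
    exact ((hL (P z)).comp z hz'.hasFDerivAt).fderiv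
  -- Continuity of `DP` suffices: the factor `L' (P z)` vanishes at `y`, so the term with `D²P` is
  -- absent.
  have hD : ContinuousAt (fderiv ℝ P) y := (hP.fderiv_right (m := 0) (by simp)).continuousAt
  have h2 := hasFDerivAt_bilin_of_eq_zero (ContinuousLinearMap.compL ℝ Y X ℝ)
    (hL'.comp y (hP.differentiableAt one_ne_zero).hasFDerivAt) h0 hD
  rw [(h2.congr_of_eventuallyEq h1).fderiv]
  rfl

/-- Second-order Taylor lower bound along a segment starting at a critical point. -/
theorem add_half_le_of_le_second_deriv {L : X → ℝ} {L' : X → X →L[ℝ] ℝ}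
    {L'' : X → X →L[ℝ] X →L[ℝ] ℝ} (hL : ∀ x, HasFDerivAt L (L' x) x)
    (hL' : ∀ x, HasFDerivAt L' (L'' x) x) {x v : X} (h0 : L' x = 0) {c : ℝ}
    (hc : ∀ s ∈ Icc (0 : ℝ) 1, c ≤ L'' (x + s • v) v v) : L x + c / 2 ≤ L (x + v) := by
  have hline : ∀ s : ℝ, HasDerivAt (fun s : ℝ => x + s • v) v s := fun s => by
    simpa using ((hasDerivAt_id s).smul_const v).const_add x
  have d1 : ∀ s : ℝ, HasDerivAt (fun s : ℝ => L (x + s • v)) (L' (x + s • v) v) s := fun s =>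
    (hL _).comp_hasDerivAt s (hline s)
  have d2 : ∀ s : ℝ, HasDerivAt (fun s : ℝ => L' (x + s • v) v) (L'' (x + s • v) v v) s := fun s => by
    have h := (hL' _).comp_hasDerivAt s (hline s)
    exact (h.clm_apply (hasDerivAt_const s v)).congr_deriv (by simp)
  -- Two integrations of the lower bound `c`, phrased as monotonicity so that no continuity of `L''`
  -- is required.
  have m1 : MonotoneOn (fun s : ℝ => L' (x + s • v) v - c * s) (Icc 0 1) := by
    refine monotoneOn_of_hasDerivWithinAt_nonneg (convex_Icc 0 1)
      (f' := fun s => L'' (x + s • v) v v - c * 1)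
      (fun s _ => ((d2 s).sub ((hasDerivAt_id s).const_mul c)).continuousAt.continuousWithinAt)
      (fun s _ => ((d2 s).sub ((hasDerivAt_id s).const_mul c)).hasDerivWithinAt) ?_
    intro s hs
    have := hc s (interior_subset hs)
    linarith
  have m2 : MonotoneOn (fun s : ℝ => L (x + s • v) - c * (s ^ 2 / 2)) (Icc 0 1) := by
    have d : ∀ s : ℝ, HasDerivAt (fun s : ℝ => L (x + s • v) - c * (s ^ 2 / 2))
        (L' (x + s • v) v - c * s) s := fun s => by
      refine ((d1 s).sub (((hasDerivAt_pow 2 s).div_const 2).const_mul c)).congr_deriv ?_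
      simp
    refine monotoneOn_of_hasDerivWithinAt_nonneg (convex_Icc 0 1)
      (f' := fun s => L' (x + s • v) v - c * s)
      (fun s _ => (d s).continuousAt.continuousWithinAt)
      (fun s _ => (d s).hasDerivWithinAt) ?_
    intro s hs
    have hs' := interior_subset hs
    have := m1 (left_mem_Icc.2 zero_le_one) hs' hs'.1
    simpa [h0] using this
  have := m2 (left_mem_Icc.2 zero_le_one) (right_mem_Icc.2 zero_le_one) zero_le_one
  simp only [zero_smul, add_zero, one_smul] at this
  linarith

end Calculus

/-! ### Second derivatives and `L_2` estimates. -/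

section SecondDerivative

variable {n m : ℕ} {T : ℝ} {F : Type*} [NormedAddCommGroup F] [NormedSpace ℝ F]

/-- The operator `A ↦ (a ↦ ∫₀^· A(t) a(t) dt)` for `L_∞` families `A` of linear maps. -/
def integratedLin (n m : ℕ) (T : ℝ) (F : Type*) [NormedAddCommGroup F] [NormedSpace ℝ F] :
    Lp ((Vec n × Vec m) →L[ℝ] F) ∞ (volume : Measure (Time T)) →L[ℝ]
      ContCurve n m T →L[ℝ] C(Time T, F) :=
  (ContinuousLinearMap.compL ℝ (ContCurve n m T) _ _ (primitive T F)) ∘L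
    (ContinuousLinearMap.compL ℝ (ContCurve n m T)
      (Lp (Vec n × Vec m) ∞ (volume : Measure (Time T)))
      (Lp F ∞ (volume : Measure (Time T)))).flip pair ∘L applyL volume _ F

/-- The operator `(a, b) ↦ ∫₀^· A(t)(a(t), b(t)) dt` for an `L_∞` family `A` of bilinear maps. -/
def integratedBilin (A : Lp ((Vec n × Vec m) →L[ℝ] (Vec n × Vec m) →L[ℝ] F) ∞
    (volume : Measure (Time T))) :
    ContCurve n m T →L[ℝ] ContCurve n m T →L[ℝ] C(Time T, F) :=
  integratedLin n m T F ∘L applyL volume _ _ A ∘L pair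

theorem integratedBilin_apply (A : Lp ((Vec n × Vec m) →L[ℝ] (Vec n × Vec m) →L[ℝ] F) ∞
    (volume : Measure (Time T))) (a b : ContCurve n m T) :
    integratedBilin A a b =
      primitive T F (applyL volume _ F (applyL volume _ _ A (pair a)) (pair b)) := rfl

theorem integratedBilin_sub (A B : Lp ((Vec n × Vec m) →L[ℝ] (Vec n × Vec m) →L[ℝ] F) ∞
    (volume : Measure (Time T))) (a b : ContCurve n m T) :
    integratedBilin (A - B) a b = integratedBilin A a b - integratedBilin B a b := by
  simp only [integratedBilin_apply, map_sub, sub_apply]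

theorem hasFDerivAt_integratedDeriv
    (g' : C(Time T × (Vec n × Vec m), (Vec n × Vec m) →L[ℝ] F))
    (g'' : C(Time T × (Vec n × Vec m), (Vec n × Vec m) →L[ℝ] (Vec n × Vec m) →L[ℝ] F))
    (hg : ∀ t x, HasFDerivAt (fun y => g' (t, y)) (g'' (t, x)) x) (η : ContCurve n m T) :
    HasFDerivAt (integratedDeriv g') (integratedBilin (nemytskii g'' (pair η))) η := by
  have h := (hasFDerivAt_nemytskii g' g'' hg (pair η)).comp η (pair (n := n) (m := m) (T := T)).hasFDerivAt
  have hM : HasFDerivAt (integratedLin n m T F) (integratedLin n m T F) (nemytskii g' (pair η)) :=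
    ContinuousLinearMap.hasFDerivAt (F := ContCurve n m T →L[ℝ] C(Time T, F)) _
  exact HasFDerivAt.comp (F := Lp ((Vec n × Vec m) →L[ℝ] F) ∞ (volume : Measure (Time T)))
    (G := ContCurve n m T →L[ℝ] C(Time T, F)) η hM h

theorem integrable_sq_Linfty (w : Lp F ∞ (volume : Measure (Time T))) :
    Integrable fun t => ‖w t‖ ^ 2 :=
  ((Lp.memLp w).mono_exponent le_top).integrable_norm_pow (p := 2) two_ne_zero

theorem integrable_normSq (a : ContCurve n m T) :
    Integrable fun t : Time T => ‖a.1 t‖ ^ 2 + ‖a.2 t‖ ^ 2 :=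
  ((a.1.continuous.norm.pow 2 : Continuous fun t : Time T => ‖a.1 t‖ ^ 2).integrable_of_hasCompactSupport
    (HasCompactSupport.of_compactSpace _)).add (integrable_sq_Linfty a.2)

theorem normSqL2_nonneg (a : ContCurve n m T) : 0 ≤ normSqL2 a :=
  integral_nonneg fun _ => by positivity

theorem integral_norm_sq_pair_le (a : ContCurve n m T) : ∫ t, ‖pair a t‖ ^ 2 ≤ normSqL2 a := by
  refine integral_mono_ae (integrable_sq_Linfty _) (integrable_normSq a) ?_
  filter_upwards [coeFn_pair a] with t ht
  -- The product carries the maximum norm, hence an inequality and not an equality.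
  rw [ht, Prod.norm_def]
  rcases max_cases ‖a.1 t‖ ‖a.2 t‖ with h | h <;> simp only [h.1] <;>
    nlinarith [sq_nonneg ‖a.1 t‖, sq_nonneg ‖a.2 t‖]

theorem normSqL2_add_le (a b : ContCurve n m T) :
    normSqL2 (a + b) ≤ 2 * (normSqL2 a + normSqL2 b) := by
  unfold normSqL2
  rw [← integral_add (integrable_normSq a) (integrable_normSq b), ← integral_const_mul]
  refine integral_mono_ae (integrable_normSq _)
    (((integrable_normSq a).add (integrable_normSq b)).const_mul 2) ?_
  filter_upwards [Lp.coeFn_add a.2 b.2] with t ht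
  rw [Prod.snd_add, ht, Prod.fst_add, ContinuousMap.add_apply, Pi.add_apply]
  have h1 := norm_add_le (a.1 t) (b.1 t)
  have h2 := norm_add_le (a.2 t) (b.2 t)
  have h3 : ‖a.1 t + b.1 t‖ ^ 2 ≤ (‖a.1 t‖ + ‖b.1 t‖) ^ 2 := by gcongr
  have h4 : ‖a.2 t + b.2 t‖ ^ 2 ≤ (‖a.2 t‖ + ‖b.2 t‖) ^ 2 := by gcongr
  nlinarith [sq_nonneg (‖a.1 t‖ - ‖b.1 t‖), sq_nonneg (‖a.2 t‖ - ‖b.2 t‖)]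

theorem normSqL2_le (a : ContCurve n m T) :
    normSqL2 a ≤ (volume : Measure (Time T)).real univ * (2 * ‖a‖ ^ 2) := by
  have h := integral_mono_ae (integrable_normSq a) (integrable_const (2 * ‖a‖ ^ 2)) (by
    filter_upwards [ae_norm_le_norm_Linfty a.2] with t ht
    have h1 : ‖a.1 t‖ ≤ ‖a‖ := (a.1.norm_coe_le_norm t).trans (norm_fst_le a)
    have h2 : ‖a.2 t‖ ≤ ‖a‖ := ht.trans (norm_snd_le a)
    have h3 : ‖a.1 t‖ ^ 2 ≤ ‖a‖ ^ 2 := by gcongr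
    have h4 : ‖a.2 t‖ ^ 2 ≤ ‖a‖ ^ 2 := by gcongr
    linarith)
  simpa [normSqL2] using h

/-- Cauchy–Schwarz, from expanding the nonnegative integral of `(V ‖w‖ - I)²`. -/
theorem sq_integral_norm_le (w : Lp F ∞ (volume : Measure (Time T))) :
    (∫ t, ‖w t‖) ^ 2 ≤ (volume : Measure (Time T)).real univ * ∫ t, ‖w t‖ ^ 2 := by
  set V := (volume : Measure (Time T)).real univ
  set I := ∫ t, ‖w t‖
  have h : 0 ≤ ∫ t, (V * ‖w t‖ - I) ^ 2 := integral_nonneg fun _ => sq_nonneg _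
  have h2 : ∫ t, (V * ‖w t‖ - I) ^ 2 = V ^ 2 * (∫ t, ‖w t‖ ^ 2) - 2 * V * I * I + V * I ^ 2 := by
    have e : ∀ t, (V * ‖w t‖ - I) ^ 2 = V ^ 2 * ‖w t‖ ^ 2 - 2 * V * I * ‖w t‖ + I ^ 2 := fun t => by ring
    simp only [e]
    have i1 := (integrable_sq_Linfty w).const_mul (V ^ 2)
    have i2 := (integrable_Linfty w).norm.const_mul (2 * V * I)
    rw [integral_add (μ := volume) (f := fun t => V ^ 2 * ‖w t‖ ^ 2 - 2 * V * I * ‖w t‖)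
      (g := fun _ => I ^ 2) (i1.sub i2) (integrable_const _), integral_sub i1 i2, integral_const_mul, integral_const_mul]
    simp [V, I]
  rw [h2] at h
  have hV : 0 ≤ V := measureReal_nonneg
  rcases hV.eq_or_lt with hV0 | hV0
  · have := integral_norm_le w
    have h3 : I ≤ 0 := by simpa [V, I, ← hV0] using this
    have h4 : 0 ≤ I := integral_nonneg fun _ => norm_nonneg _
    have : I = 0 := le_antisymm h3 h4
    rw [this, ← hV0]; simp
  · by_contra! hc
    nlinarith

/-- The sup norm of a primitive is at most the `L_1` norm of the integrand, and the product splits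
by Young's inequality. Hence `L_2` norms control the form even after a functional on continuous
curves is applied; the weight `κ` lets the small argument absorb the large constant. -/
theorem norm_integratedBilin_le (A : Lp ((Vec n × Vec m) →L[ℝ] (Vec n × Vec m) →L[ℝ] F) ∞
    (volume : Measure (Time T))) (a b : ContCurve n m T) {κ : ℝ} (hκ : 0 < κ) :
    ‖integratedBilin A a b‖ ≤ ‖A‖ * (κ * normSqL2 a + κ⁻¹ * normSqL2 b) := by
  rw [integratedBilin_apply]
  refine (norm_primitive_le _).trans ?_
  have hi := ((integrable_sq_Linfty (pair a)).const_mul κ).add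
    ((integrable_sq_Linfty (pair b)).const_mul κ⁻¹)
  calc _ ≤ ∫ t, ‖A‖ * (κ * ‖pair a t‖ ^ 2 + κ⁻¹ * ‖pair b t‖ ^ 2) := by
        refine integral_mono_ae (integrable_Linfty _).norm (hi.const_mul ‖A‖) ?_
        filter_upwards [coeFn_applyL (applyL volume _ _ A (pair a)) (pair b),
          coeFn_applyL A (pair a), ae_norm_le_norm_Linfty A] with t h1 h2 h3
        rw [h1, h2]
        refine (((A t).le_opNorm₂ _ _).trans ?_)
        rw [mul_assoc]
        have hk : ‖pair a t‖ * ‖pair b t‖ ≤ κ * ‖pair a t‖ ^ 2 + κ⁻¹ * ‖pair b t‖ ^ 2 := by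
          have e : κ * ‖pair a t‖ ^ 2 + κ⁻¹ * ‖pair b t‖ ^ 2 - ‖pair a t‖ * ‖pair b t‖ =
            κ⁻¹ * ((κ * ‖pair a t‖ - ‖pair b t‖ / 2) ^ 2 + 3 / 4 * ‖pair b t‖ ^ 2) := by
            field_simp; ring
          have : 0 ≤ κ⁻¹ * ((κ * ‖pair a t‖ - ‖pair b t‖ / 2) ^ 2 + 3 / 4 * ‖pair b t‖ ^ 2) := by
            positivity
          linarith
        gcongr
    _ = ‖A‖ * (κ * (∫ t, ‖pair a t‖ ^ 2) + κ⁻¹ * ∫ t, ‖pair b t‖ ^ 2) := by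
        rw [integral_const_mul, integral_add ((integrable_sq_Linfty (pair a)).const_mul κ)
          ((integrable_sq_Linfty (pair b)).const_mul κ⁻¹), integral_const_mul, integral_const_mul]
    _ ≤ _ := by
        gcongr
        · exact integral_norm_sq_pair_le a
        · exact integral_norm_sq_pair_le b

end SecondDerivative

/-! ### Differences of trajectories, the Lagrangian and its derivatives. -/

section Lagrange

variable {n m : ℕ} {T : ℝ}

section TrajectoryDifferences

variable {g : C(Time T × (Vec n × Vec m), Vec n)}
  {g' : C(Time T × (Vec n × Vec m), (Vec n × Vec m) →L[ℝ] Vec n)}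
  {c : C(Time T, Vec n)} {ξ₀ : ContCurve n m T}

theorem sub_fst_eq_primitive (h₀ : ξ₀.1 = c + integrated g ξ₀) {ξ : ContCurve n m T}
    (hξ : ξ.1 = c + integrated g ξ) :
    (ξ - ξ₀).1 = primitive T (Vec n) (nemytskii g (pair ξ) - nemytskii g (pair ξ₀)) := by
  rw [Prod.fst_sub, hξ, h₀, add_sub_add_left_eq_sub, map_sub]
  rfl

/-- Both curves solve the same integral equation, so a Lipschitz bound for `g` controls the state in
sup norm by an `L_1` norm. This is what bounds the final state in `L_2`. -/
theorem exists_norm_sub_fst_le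
    (hg : ∀ t x, HasFDerivAt (fun y => g (t, y)) (g' (t, x)) x)
    (h₀ : ξ₀.1 = c + integrated g ξ₀) :
    ∃ L, 0 ≤ L ∧ ∀ ξ : ContCurve n m T, ξ.1 = c + integrated g ξ → ‖pair (ξ - ξ₀)‖ ≤ 1 →
      ‖(ξ - ξ₀).1‖ ≤ L * ∫ t, ‖pair (ξ - ξ₀) t‖ := by
  obtain ⟨L, hL, hlip⟩ := exists_lipschitz_on_ball g g' hg (‖pair ξ₀‖ + 1)
  refine ⟨L, hL, fun ξ hξ h1 => ?_⟩
  rw [sub_fst_eq_primitive h₀ hξ]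
  refine (norm_primitive_le _).trans ?_
  rw [← integral_const_mul]
  refine integral_mono_ae (integrable_Linfty _).norm ((integrable_Linfty _).norm.const_mul L) ?_
  have hb : ‖pair ξ‖ ≤ ‖pair ξ₀‖ + 1 := by
    rw [map_sub] at h1
    have := norm_sub_norm_le (pair ξ) (pair ξ₀)
    linarith
  rw [map_sub]
  filter_upwards [coeFn_nemytskii g (pair ξ), coeFn_nemytskii g (pair ξ₀),
    Lp.coeFn_sub (nemytskii g (pair ξ)) (nemytskii g (pair ξ₀)),
    Lp.coeFn_sub (pair ξ) (pair ξ₀), ae_norm_le_norm_Linfty (pair ξ),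
    ae_norm_le_norm_Linfty (pair ξ₀)] with t h4 h5 h6 h7 h8 h9
  rw [h6, Pi.sub_apply, h4, h5, h7, Pi.sub_apply]
  exact hlip t _ _ (h8.trans hb) (h9.trans (by linarith))

/-- The residual is the primitive of a pointwise Taylor remainder; `L_∞` closeness makes it at most
`ε ‖ζ(t)‖`, so it is of higher order already in `L_1`. -/
theorem exists_norm_linearization_le
    (hg : ∀ t x, HasFDerivAt (fun y => g (t, y)) (g' (t, x)) x)
    (h₀ : ξ₀.1 = c + integrated g ξ₀) {ε : ℝ} (hε : 0 < ε) :
    ∃ δ, 0 < δ ∧ ∀ ξ : ContCurve n m T, ξ.1 = c + integrated g ξ → ‖pair (ξ - ξ₀)‖ < δ →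
      ‖(ξ - ξ₀).1 - integratedDeriv g' ξ₀ (ξ - ξ₀)‖ ≤ ε * ∫ t, ‖pair (ξ - ξ₀) t‖ := by
  obtain ⟨δ, hδ, hrem⟩ := exists_remainder_le_on_ball g g' hg ‖pair ξ₀‖ hε
  refine ⟨δ, hδ, fun ξ hξ h1 => ?_⟩
  have e : (ξ - ξ₀).1 - integratedDeriv g' ξ₀ (ξ - ξ₀) =
      primitive T (Vec n) (nemytskii g (pair ξ) - nemytskii g (pair ξ₀) -
        applyL volume _ _ (nemytskii g' (pair ξ₀)) (pair (ξ - ξ₀))) := by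
    rw [sub_fst_eq_primitive h₀ hξ, map_sub (primitive T (Vec n)) (_ - _)]
    rfl
  rw [e]
  refine (norm_primitive_le _).trans ?_
  rw [← integral_const_mul]
  refine integral_mono_ae (integrable_Linfty _).norm ((integrable_Linfty _).norm.const_mul ε) ?_
  filter_upwards [coeFn_nemytskii g (pair ξ), coeFn_nemytskii g (pair ξ₀),
    coeFn_nemytskii g' (pair ξ₀),
    coeFn_applyL (nemytskii g' (pair ξ₀)) (pair (ξ - ξ₀)),
    Lp.coeFn_sub (nemytskii g (pair ξ)) (nemytskii g (pair ξ₀)),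
    Lp.coeFn_sub (nemytskii g (pair ξ) - nemytskii g (pair ξ₀))
      (applyL volume _ _ (nemytskii g' (pair ξ₀)) (pair (ξ - ξ₀))),
    Lp.coeFn_sub (pair ξ) (pair ξ₀), ae_norm_le_norm_Linfty (pair (ξ - ξ₀)),
    ae_norm_le_norm_Linfty (pair ξ₀)] with t h2 h3 h4 h5 h6 h7 h8 h9 h10
  rw [h7, Pi.sub_apply, h6, Pi.sub_apply, h2, h3, h5, h4]
  have h11 : pair ξ t = pair ξ₀ t + pair (ξ - ξ₀) t := by
    rw [map_sub, h8, Pi.sub_apply, add_sub_cancel]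
  rw [h11]
  exact hrem t _ _ h10 (h9.trans_lt h1)

end TrajectoryDifferences

section Lagrangian

/-- The final state, as a continuous linear map. -/
def finalState (hT : 0 < T) : ContCurve n m T →L[ℝ] Vec n :=
  ContinuousMap.evalCLM ℝ (finalTime hT) ∘L ContinuousLinearMap.fst ℝ _ _

theorem norm_finalState_le (hT : 0 < T) (a : ContCurve n m T) : ‖finalState hT a‖ ≤ ‖a.1‖ :=
  a.1.norm_coe_le_norm _

/-- The squared `L_2` norm together with the squared norm of the final state. -/
def energy (hT : 0 < T) (a : ContCurve n m T) : ℝ := normSqL2 a + ‖finalState hT a‖ ^ 2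

theorem energy_nonneg (hT : 0 < T) (a : ContCurve n m T) : 0 ≤ energy hT a :=
  add_nonneg (normSqL2_nonneg a) (sq_nonneg _)

theorem normSqL2_le_energy (hT : 0 < T) (a : ContCurve n m T) : normSqL2 a ≤ energy hT a :=
  le_add_of_nonneg_right (sq_nonneg _)

theorem energy_add_le (hT : 0 < T) (a b : ContCurve n m T) :
    energy hT (a + b) ≤ 2 * (energy hT a + energy hT b) := by
  unfold energy
  have h1 := normSqL2_add_le a b
  have h2 : ‖finalState hT (a + b)‖ ^ 2 ≤ (‖finalState hT a‖ + ‖finalState hT b‖) ^ 2 := by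
    rw [map_add]
    gcongr
    exact norm_add_le _ _
  nlinarith [sq_nonneg (‖finalState hT a‖ - ‖finalState hT b‖)]

theorem energy_le (hT : 0 < T) (a : ContCurve n m T) :
    energy hT a ≤ (2 * (volume : Measure (Time T)).real univ + 1) * ‖a‖ ^ 2 := by
  have h1 := normSqL2_le a
  have h2 : ‖finalState hT a‖ ^ 2 ≤ ‖a‖ ^ 2 := by
    gcongr
    exact (norm_finalState_le hT a).trans (norm_fst_le a)
  unfold energy
  linarith

/-- The derivative of the cost functional. -/
def costDeriv (hT : 0 < T) (l' : C(Time T × (Vec n × Vec m), (Vec n × Vec m) →L[ℝ] ℝ))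
    (φ' : Vec n → Vec n →L[ℝ] ℝ) (η : ContCurve n m T) : ContCurve n m T →L[ℝ] ℝ :=
  ContinuousMap.evalCLM ℝ (finalTime hT) ∘L integratedDeriv l' η +
    φ' (finalState hT η) ∘L finalState hT

theorem cost_eq (hT : 0 < T) {l : Time T → Vec n × Vec m → ℝ}
    (lC : C(Time T × (Vec n × Vec m), ℝ)) (hl : ∀ t x, lC (t, x) = l t x) (φ : Vec n → ℝ)
    (η : ContCurve n m T) :
    cost hT l φ η = integrated lC η (finalTime hT) + φ (finalState hT η) := by
  have h1 : Iic (finalTime hT) = univ := eq_univ_of_forall fun t => t.2.2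
  rw [cost, integrated, primitive_apply, h1, setIntegral_univ]
  congr 1
  refine integral_congr_ae ?_
  filter_upwards [coeFn_nemytskii lC (pair η), coeFn_pair η] with t h2 h3
  rw [h2, h3, hl]

theorem hasFDerivAt_cost (hT : 0 < T) {l : Time T → Vec n × Vec m → ℝ}
    {lC : C(Time T × (Vec n × Vec m), ℝ)} (hl : ∀ t x, lC (t, x) = l t x)
    {l' : C(Time T × (Vec n × Vec m), (Vec n × Vec m) →L[ℝ] ℝ)}
    (hl' : ∀ t x, HasFDerivAt (fun y => lC (t, y)) (l' (t, x)) x)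
    {φ : Vec n → ℝ} {φ' : Vec n → Vec n →L[ℝ] ℝ} (hφ : ∀ x, HasFDerivAt φ (φ' x) x)
    (η : ContCurve n m T) : HasFDerivAt (cost hT l φ) (costDeriv hT l' φ' η) η := by
  rw [funext (cost_eq hT lC hl φ)]
  exact ((ContinuousMap.evalCLM ℝ (finalTime hT)).hasFDerivAt.comp η
    (hasFDerivAt_integrated lC l' hl' η)).add ((hφ _).comp η (finalState hT).hasFDerivAt)

/-- The bilinear form `∫ A(a, b) + H(a(T), b(T)) + lam (∫₀^· B(a, b))`. -/
def lagrangianForm (hT : 0 < T) (lam : C(Time T, Vec n) →L[ℝ] ℝ)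
    (A : Lp ((Vec n × Vec m) →L[ℝ] (Vec n × Vec m) →L[ℝ] ℝ) ∞ (volume : Measure (Time T)))
    (B : Lp ((Vec n × Vec m) →L[ℝ] (Vec n × Vec m) →L[ℝ] Vec n) ∞ (volume : Measure (Time T)))
    (H : Vec n →L[ℝ] Vec n →L[ℝ] ℝ) : ContCurve n m T →L[ℝ] ContCurve n m T →L[ℝ] ℝ :=
  ContinuousLinearMap.compL ℝ (ContCurve n m T) _ _ (ContinuousMap.evalCLM ℝ (finalTime hT)) ∘L
      integratedBilin A +
    (ContinuousLinearMap.compL ℝ (ContCurve n m T) (Vec n) ℝ).flip (finalState hT) ∘L H ∘L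
      finalState hT +
    ContinuousLinearMap.compL ℝ (ContCurve n m T) _ _ lam ∘L integratedBilin B

theorem lagrangianForm_apply (hT : 0 < T) (lam : C(Time T, Vec n) →L[ℝ] ℝ)
    (A : Lp ((Vec n × Vec m) →L[ℝ] (Vec n × Vec m) →L[ℝ] ℝ) ∞ (volume : Measure (Time T)))
    (B : Lp ((Vec n × Vec m) →L[ℝ] (Vec n × Vec m) →L[ℝ] Vec n) ∞ (volume : Measure (Time T)))
    (H : Vec n →L[ℝ] Vec n →L[ℝ] ℝ) (a b : ContCurve n m T) :
    lagrangianForm hT lam A B H a b = integratedBilin A a b (finalTime hT) +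
      H (finalState hT a) (finalState hT b) + lam (integratedBilin B a b) := rfl

/-- The final-cost term is not bounded by `L_2` norms for arbitrary curves, which is why `energy`
includes the final state. -/
theorem abs_lagrangianForm_le (hT : 0 < T) (lam : C(Time T, Vec n) →L[ℝ] ℝ)
    (A : Lp ((Vec n × Vec m) →L[ℝ] (Vec n × Vec m) →L[ℝ] ℝ) ∞ (volume : Measure (Time T)))
    (B : Lp ((Vec n × Vec m) →L[ℝ] (Vec n × Vec m) →L[ℝ] Vec n) ∞ (volume : Measure (Time T)))
    (H : Vec n →L[ℝ] Vec n →L[ℝ] ℝ) (a b : ContCurve n m T) {κ : ℝ} (hκ : 0 < κ) :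
    |lagrangianForm hT lam A B H a b| ≤
      (‖A‖ + ‖H‖ + ‖lam‖ * ‖B‖) * (κ * energy hT a + κ⁻¹ * energy hT b) := by
  have hab : κ * normSqL2 a + κ⁻¹ * normSqL2 b ≤ κ * energy hT a + κ⁻¹ * energy hT b := by
    gcongr <;> exact normSqL2_le_energy hT _
  have h1 : |integratedBilin A a b (finalTime hT)| ≤
      ‖A‖ * (κ * energy hT a + κ⁻¹ * energy hT b) :=
    ((integratedBilin A a b).norm_coe_le_norm _).trans
      ((norm_integratedBilin_le A a b hκ).trans (by gcongr))
  have h2 : |H (finalState hT a) (finalState hT b)| ≤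
      ‖H‖ * (κ * energy hT a + κ⁻¹ * energy hT b) := by
    refine (H.le_opNorm₂ _ _).trans ?_
    rw [mul_assoc]
    gcongr
    set x := ‖finalState hT a‖
    set y := ‖finalState hT b‖
    have e : κ * x ^ 2 + κ⁻¹ * y ^ 2 - x * y = κ⁻¹ * ((κ * x - y / 2) ^ 2 + 3 / 4 * y ^ 2) := by
      field_simp; ring
    have e' : 0 ≤ κ⁻¹ * ((κ * x - y / 2) ^ 2 + 3 / 4 * y ^ 2) := by positivity
    have e1 : κ * x ^ 2 ≤ κ * energy hT a := by
      gcongr; exact le_add_of_nonneg_left (normSqL2_nonneg a)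
    have e2 : κ⁻¹ * y ^ 2 ≤ κ⁻¹ * energy hT b := by
      gcongr; exact le_add_of_nonneg_left (normSqL2_nonneg b)
    linarith
  have h3 : |lam (integratedBilin B a b)| ≤
      ‖lam‖ * ‖B‖ * (κ * energy hT a + κ⁻¹ * energy hT b) := by
    refine (lam.le_opNorm _).trans ?_
    rw [mul_assoc]
    gcongr
    exact (norm_integratedBilin_le B a b hκ).trans (by gcongr)
  rw [lagrangianForm_apply]
  refine (abs_add_three _ _ _).trans ?_
  linarith

/-- Linearity in the coefficients turns continuity in the base point into an instance of
`abs_lagrangianForm_le`. -/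
theorem lagrangianForm_sub (hT : 0 < T) (lam : C(Time T, Vec n) →L[ℝ] ℝ)
    (A A' : Lp ((Vec n × Vec m) →L[ℝ] (Vec n × Vec m) →L[ℝ] ℝ) ∞ (volume : Measure (Time T)))
    (B B' : Lp ((Vec n × Vec m) →L[ℝ] (Vec n × Vec m) →L[ℝ] Vec n) ∞ (volume : Measure (Time T)))
    (H H' : Vec n →L[ℝ] Vec n →L[ℝ] ℝ) (a b : ContCurve n m T) :
    lagrangianForm hT lam (A - A') (B - B') (H - H') a b =
      lagrangianForm hT lam A B H a b - lagrangianForm hT lam A' B' H' a b := by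
  simp only [lagrangianForm_apply, integratedBilin_sub, ContinuousMap.sub_apply, map_sub,
    sub_apply]
  ring

/-- The cost minus a multiplier applied to the dynamic constraint `x - c - ∫₀^· g = 0`. -/
def lagrangian (hT : 0 < T) (l : Time T → Vec n × Vec m → ℝ) (φ : Vec n → ℝ)
    (lam : C(Time T, Vec n) →L[ℝ] ℝ) (g : C(Time T × (Vec n × Vec m), Vec n))
    (c : C(Time T, Vec n)) (η : ContCurve n m T) : ℝ :=
  cost hT l φ η - lam (η.1 - (c + integrated g η))

/-- The derivative of the Lagrangian. -/
def lagrangianDeriv (hT : 0 < T) (l' : C(Time T × (Vec n × Vec m), (Vec n × Vec m) →L[ℝ] ℝ))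
    (φ' : Vec n → Vec n →L[ℝ] ℝ) (lam : C(Time T, Vec n) →L[ℝ] ℝ)
    (g' : C(Time T × (Vec n × Vec m), (Vec n × Vec m) →L[ℝ] Vec n)) (η : ContCurve n m T) :
    ContCurve n m T →L[ℝ] ℝ :=
  costDeriv hT l' φ' η - lam ∘L (ContinuousLinearMap.fst ℝ _ _ - integratedDeriv g' η)

variable {lC : C(Time T × (Vec n × Vec m), ℝ)}
  {l' : C(Time T × (Vec n × Vec m), (Vec n × Vec m) →L[ℝ] ℝ)}
  {l'' : C(Time T × (Vec n × Vec m), (Vec n × Vec m) →L[ℝ] (Vec n × Vec m) →L[ℝ] ℝ)}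
  {g : C(Time T × (Vec n × Vec m), Vec n)}
  {g' : C(Time T × (Vec n × Vec m), (Vec n × Vec m) →L[ℝ] Vec n)}
  {g'' : C(Time T × (Vec n × Vec m), (Vec n × Vec m) →L[ℝ] (Vec n × Vec m) →L[ℝ] Vec n)}
  {φ : Vec n → ℝ} {φ' : Vec n → Vec n →L[ℝ] ℝ} {φ'' : Vec n → Vec n →L[ℝ] Vec n →L[ℝ] ℝ}

theorem hasFDerivAt_lagrangian (hT : 0 < T) {l : Time T → Vec n × Vec m → ℝ}
    (hl : ∀ t x, lC (t, x) = l t x)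
    (hl' : ∀ t x, HasFDerivAt (fun y => lC (t, y)) (l' (t, x)) x)
    (hφ : ∀ x, HasFDerivAt φ (φ' x) x)
    (hg : ∀ t x, HasFDerivAt (fun y => g (t, y)) (g' (t, x)) x)
    (lam : C(Time T, Vec n) →L[ℝ] ℝ) (c : C(Time T, Vec n)) (η : ContCurve n m T) :
    HasFDerivAt (lagrangian hT l φ lam g c) (lagrangianDeriv hT l' φ' lam g' η) η :=
  (hasFDerivAt_cost hT hl hl' hφ η).sub
    (lam.hasFDerivAt.comp η (hasFDerivAt_fst.sub ((hasFDerivAt_integrated g g' hg η).const_add c)))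

theorem hasFDerivAt_lagrangianDeriv (hT : 0 < T)
    (hl'' : ∀ t x, HasFDerivAt (fun y => l' (t, y)) (l'' (t, x)) x)
    (hφ' : ∀ x, HasFDerivAt φ' (φ'' x) x)
    (hg' : ∀ t x, HasFDerivAt (fun y => g' (t, y)) (g'' (t, x)) x)
    (lam : C(Time T, Vec n) →L[ℝ] ℝ) (η : ContCurve n m T) :
    HasFDerivAt (lagrangianDeriv hT l' φ' lam g')
      (lagrangianForm hT lam (nemytskii l'' (pair η)) (nemytskii g'' (pair η))
        (φ'' (finalState hT η))) η := by
  have h1 := (hasFDerivAt_const (ContinuousMap.evalCLM ℝ (finalTime hT) : C(Time T, ℝ) →L[ℝ] ℝ)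
    η).clm_comp (hasFDerivAt_integratedDeriv l' l'' hl'' η)
  have h2 := ((hφ' _).comp η (finalState (m := m) hT).hasFDerivAt).clm_comp
    (hasFDerivAt_const (finalState (m := m) hT) η)
  have h3 := (hasFDerivAt_const lam η).clm_comp
    ((hasFDerivAt_const (ContinuousLinearMap.fst ℝ C(Time T, Vec n)
      (Lp (Vec m) ∞ (volume : Measure (Time T)))) η).sub (hasFDerivAt_integratedDeriv g' g'' hg' η))
  refine ((h1.add h2).sub h3).congr_fderiv ?_
  refine ContinuousLinearMap.ext fun a => ContinuousLinearMap.ext fun b => ?_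
  rw [lagrangianForm_apply]
  simp [sub_eq_add_neg]

end Lagrangian

/-! ### Continuous derivatives extracted from the smoothness hypotheses. -/

section Data

/-- A time-independent function, as a function of time and state. -/
def autonomous (T : ℝ) {E F : Type*} [TopologicalSpace E] [TopologicalSpace F] (f : E → F)
    (hf : Continuous f) : C(Time T × E, F) :=
  ⟨fun p => f p.2, hf.comp continuous_snd⟩

theorem hasFDerivAt_fderiv_of_contDiff_two {E F : Type*} [NormedAddCommGroup E] [NormedSpace ℝ E]
    [NormedAddCommGroup F] [NormedSpace ℝ F] {f : E → F} (hf : ContDiff ℝ 2 f) :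
    (∀ x, HasFDerivAt f (fderiv ℝ f x) x) ∧
      (∀ x, HasFDerivAt (fderiv ℝ f) (fderiv ℝ (fderiv ℝ f) x) x) ∧
      Continuous (fderiv ℝ f) ∧ Continuous (fderiv ℝ (fderiv ℝ f)) := by
  have h1 : ContDiff ℝ 1 (fderiv ℝ f) := hf.fderiv_right (by norm_num)
  exact ⟨fun x => (hf.differentiable (by norm_num) x).hasFDerivAt,
    fun x => (h1.differentiable (by norm_num) x).hasFDerivAt, h1.continuous,
    h1.continuous_fderiv (by norm_num)⟩

theorem continuous_iteratedFDeriv_succ {α E F : Type*} [TopologicalSpace α]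
    [NormedAddCommGroup E] [NormedSpace ℝ E] [NormedAddCommGroup F] [NormedSpace ℝ F]
    {l : α → E → F} {k : ℕ}
    (h : Continuous fun p : α × E => iteratedFDeriv ℝ (k + 1) (l p.1) p.2) :
    Continuous fun p : α × E => iteratedFDeriv ℝ k (fderiv ℝ (l p.1)) p.2 := by
  have e : (fun p : α × E => iteratedFDeriv ℝ k (fderiv ℝ (l p.1)) p.2) = fun p =>
      continuousMultilinearCurryRightEquiv' ℝ k E F (iteratedFDeriv ℝ (k + 1) (l p.1) p.2) := by
    ext1 p
    rw [iteratedFDeriv_succ_eq_comp_right, Function.comp_apply,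
      LinearIsometryEquiv.apply_symm_apply]
  rw [e]
  exact (LinearIsometryEquiv.continuous _).comp h

theorem continuous_of_iteratedFDeriv_zero {α E F : Type*} [TopologicalSpace α]
    [NormedAddCommGroup E] [NormedSpace ℝ E] [NormedAddCommGroup F] [NormedSpace ℝ F]
    {l : α → E → F} (h : Continuous fun p : α × E => iteratedFDeriv ℝ 0 (l p.1) p.2) :
    Continuous fun p : α × E => l p.1 p.2 := by
  have e : (fun p : α × E => l p.1 p.2) = fun p =>
      continuousMultilinearCurryFin0 ℝ E F (iteratedFDeriv ℝ 0 (l p.1) p.2) := by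
    ext1 p
    simp
  rw [e]
  exact (LinearIsometryEquiv.continuous _).comp h

theorem IsRunningCost.exists_derivatives {l : Time T → Vec n × Vec m → ℝ} (hl : IsRunningCost l) :
    ∃ (lC : C(Time T × (Vec n × Vec m), ℝ))
      (l' : C(Time T × (Vec n × Vec m), (Vec n × Vec m) →L[ℝ] ℝ))
      (l'' : C(Time T × (Vec n × Vec m), (Vec n × Vec m) →L[ℝ] (Vec n × Vec m) →L[ℝ] ℝ)),
      (∀ t x, lC (t, x) = l t x) ∧
      (∀ t x, HasFDerivAt (fun y => lC (t, y)) (l' (t, x)) x) ∧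
      (∀ t x, HasFDerivAt (fun y => l' (t, y)) (l'' (t, x)) x) := by
  have h0 : Continuous fun p : Time T × (Vec n × Vec m) => l p.1 p.2 :=
    continuous_of_iteratedFDeriv_zero (hl.2 0 (by norm_num))
  have h1 : Continuous fun p : Time T × (Vec n × Vec m) => fderiv ℝ (l p.1) p.2 :=
    continuous_of_iteratedFDeriv_zero (l := fun t => fderiv ℝ (l t))
      (continuous_iteratedFDeriv_succ (hl.2 1 (by norm_num)))
  have h2 : Continuous fun p : Time T × (Vec n × Vec m) => fderiv ℝ (fderiv ℝ (l p.1)) p.2 :=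
    continuous_of_iteratedFDeriv_zero (l := fun t => fderiv ℝ (fderiv ℝ (l t)))
      (continuous_iteratedFDeriv_succ (l := fun t => fderiv ℝ (l t))
        (continuous_iteratedFDeriv_succ (k := 1) (hl.2 2 le_rfl)))
  exact ⟨⟨_, h0⟩, ⟨_, h1⟩, ⟨_, h2⟩, fun _ _ => rfl,
    fun t => (hasFDerivAt_fderiv_of_contDiff_two (hl.1 t)).1,
    fun t => (hasFDerivAt_fderiv_of_contDiff_two (hl.1 t)).2.1⟩

end Data

end Lagrange

/-! ### Second-order sufficiency under the two-norm discrepancy. -/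

section Sufficiency

/-- Small relative perturbations do not destroy coercivity. -/
theorem exists_pos_perturbation {c₀ C C₁ : ℝ} (hc₀ : 0 < c₀) (hC : 0 ≤ C) (hC₁ : 0 ≤ C₁) :
    ∃ κ : ℝ, 0 < κ ∧ ∀ N Nζ Nd Nγ nγ q qγ e₁ e₂ : ℝ, 0 < N → Nζ ≤ C₁ * N → Nd ≤ κ ^ 2 * N →
      Nγ ≤ 2 * (Nζ + Nd) → N / 2 - Nd ≤ nγ → c₀ * nγ ≤ qγ →
      |e₁| ≤ C * (κ * Nγ + κ⁻¹ * Nd) → |e₂| ≤ C * (κ⁻¹ * Nd + κ * Nζ) → q = qγ + e₁ + e₂ →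
      0 < q - 2 * κ * Nζ := by
  -- `D` collects the coefficients of all error terms of size `κ * N`. With `κ * D = c₀ / 4` they
  -- use up half of the margin `c₀ / 2 * N`. Here `N`, `nγ` stand for squared `L_2` norms, `Nζ`,
  -- `Nd`, `Nγ` for energies, and `e₁`, `e₂` for cross terms.
  set D := c₀ + C * (3 * C₁ + 4) + 2 * C₁
  have hD0 : c₀ ≤ D := by
    have : 0 ≤ C * (3 * C₁ + 4) := by positivity
    simp only [D]; linarith
  have hD : 0 < D := hc₀.trans_le hD0
  set κ := c₀ / (4 * D)
  have hκ : 0 < κ := by positivity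
  have hκD : κ * D = c₀ / 4 := by simp only [κ]; field_simp
  have hκ1 : κ ≤ 1 := by
    rw [div_le_one (by positivity)]; linarith
  refine ⟨κ, hκ, fun N Nζ Nd Nγ nγ q qγ e₁ e₂ hN h1 h2 h3 h4 h5 h6 h7 h8 => ?_⟩
  have k2 : κ ^ 2 * N ≤ κ * N := by
    gcongr; nlinarith
  have k3 : κ⁻¹ * Nd ≤ κ * N := by
    calc κ⁻¹ * Nd ≤ κ⁻¹ * (κ ^ 2 * N) := by gcongr
      _ = κ * N := by field_simp
  have k4 : κ * Nd ≤ κ * N := by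
    gcongr
    have : κ * N ≤ 1 * N := by gcongr
    linarith
  have k5 : κ * Nζ ≤ κ * (C₁ * N) := by gcongr
  have k6 : κ * Nγ ≤ κ * (2 * (Nζ + Nd)) := by gcongr
  have k7 : |e₁| ≤ C * (κ * (2 * C₁ + 3) * N) := by
    refine h6.trans ?_
    gcongr
    linarith
  have k8 : |e₂| ≤ C * (κ * (C₁ + 1) * N) := by
    refine h7.trans ?_
    gcongr
    linarith
  have k9 : c₀ * (N / 2 - κ * N) ≤ qγ := by
    refine le_trans ?_ h5
    gcongr
    linarith
  have k10 := neg_abs_le e₁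
  have k11 := neg_abs_le e₂
  have key : q - 2 * κ * Nζ ≥ c₀ / 2 * N - κ * D * N := by
    have : κ * D * N = c₀ * κ * N + C * (κ * (2 * C₁ + 3) * N) + C * (κ * (C₁ + 1) * N) +
      2 * (κ * (C₁ * N)) := by simp only [D]; ring
    rw [this]
    linarith
  rw [hκD] at key
  have : 0 < c₀ / 2 * N - c₀ / 4 * N := by
    have : 0 < c₀ * N := by positivity
    linarith
  linarith

variable {n m : ℕ} {T : ℝ} {f : Vec n × Vec m → Vec n}
  {lC : C(Time T × (Vec n × Vec m), ℝ)}
  {l' : C(Time T × (Vec n × Vec m), (Vec n × Vec m) →L[ℝ] ℝ)}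
  {l'' : C(Time T × (Vec n × Vec m), (Vec n × Vec m) →L[ℝ] (Vec n × Vec m) →L[ℝ] ℝ)}
  {g : C(Time T × (Vec n × Vec m), Vec n)}
  {g' : C(Time T × (Vec n × Vec m), (Vec n × Vec m) →L[ℝ] Vec n)}
  {g'' : C(Time T × (Vec n × Vec m), (Vec n × Vec m) →L[ℝ] (Vec n × Vec m) →L[ℝ] Vec n)}
  {φ : Vec n → ℝ} {φ' : Vec n → Vec n →L[ℝ] ℝ} {φ'' : Vec n → Vec n →L[ℝ] Vec n →L[ℝ] ℝ}

theorem exists_sum_norm_sub_le {X Y Z₁ Z₂ Z₃ : Type*} [NormedAddCommGroup X]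
    [NormedAddCommGroup Y] [NormedAddCommGroup Z₁] [NormedAddCommGroup Z₂] [NormedAddCommGroup Z₃]
    {h₁ : X → Z₁} {h₂ : Y → Z₂} {h₃ : X → Z₃} (c₁ : Continuous h₁) (c₂ : Continuous h₂)
    (c₃ : Continuous h₃) (x : X) (y : Y) (s : ℝ) {ε : ℝ} (hε : 0 < ε) :
    ∃ ρ, 0 < ρ ∧ ∀ x' y', ‖x' - x‖ < ρ → ‖y' - y‖ < ρ →
      ‖h₁ x' - h₁ x‖ + ‖h₂ y' - h₂ y‖ + s * ‖h₃ x' - h₃ x‖ ≤ ε := by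
  have hr : Continuous fun p : X × Y =>
      ‖h₁ p.1 - h₁ x‖ + ‖h₂ p.2 - h₂ y‖ + s * ‖h₃ p.1 - h₃ x‖ := by fun_prop
  obtain ⟨ρ, hρ, h⟩ := Metric.continuousAt_iff.1 (hr.continuousAt (x := (x, y))) ε hε
  refine ⟨ρ, hρ, fun x' y' hx hy => ?_⟩
  have h3 := @h (x', y') (by
    rw [Prod.dist_eq]
    exact max_lt (by rwa [dist_eq_norm]) (by rwa [dist_eq_norm]))
  simp only [sub_self, norm_zero, mul_zero, add_zero, dist_zero_right] at h3
  exact (le_abs_self _).trans h3.le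

/-- The second derivative of the Lagrangian is continuous in the `L_2` operator norm, uniformly
with respect to the `L_∞` distance of the base points. -/
theorem exists_abs_lagrangianForm_sub_le (hT : 0 < T) (lam : C(Time T, Vec n) →L[ℝ] ℝ)
    (hφ'' : Continuous φ'') (ξ₀ : ContCurve n m T) {ε : ℝ} (hε : 0 < ε) :
    ∃ ρ, 0 < ρ ∧ ∀ η : ContCurve n m T, ‖pair (η - ξ₀)‖ < ρ → ‖finalState hT (η - ξ₀)‖ < ρ →
      ∀ a, |lagrangianForm hT lam (nemytskii l'' (pair η)) (nemytskii g'' (pair η))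
          (φ'' (finalState hT η)) a a -
        lagrangianForm hT lam (nemytskii l'' (pair ξ₀)) (nemytskii g'' (pair ξ₀))
          (φ'' (finalState hT ξ₀)) a a| ≤ 2 * ε * energy hT a := by
  obtain ⟨ρ, hρ, h⟩ := exists_sum_norm_sub_le (Y := Vec n)
    (Z₂ := Vec n →L[ℝ] Vec n →L[ℝ] ℝ)
    (continuous_nemytskii (μ := (volume : Measure (Time T)))
      (F := (Vec n × Vec m) →L[ℝ] (Vec n × Vec m) →L[ℝ] ℝ) l'') hφ''
    (continuous_nemytskii (μ := (volume : Measure (Time T)))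
      (F := (Vec n × Vec m) →L[ℝ] (Vec n × Vec m) →L[ℝ] Vec n) g'')
    (pair ξ₀) (finalState hT ξ₀) ‖lam‖ hε
  refine ⟨ρ, hρ, fun η h1 h2 a => ?_⟩
  have h4 := h (pair η) (finalState hT η) (by rwa [← map_sub]) (by rwa [← map_sub])
  rw [← lagrangianForm_sub]
  refine (abs_lagrangianForm_le hT lam _ _ _ a a one_pos).trans ?_
  have h5 := energy_nonneg hT a
  calc _ ≤ ε * (1 * energy hT a + 1⁻¹ * energy hT a) := by gcongr
    _ = _ := by ring

theorem eq_zero_of_normSqL2_eq_zero {a : ContCurve n m T} (h : normSqL2 a = 0)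
    (h1 : a.1 = 0) : a = 0 := by
  refine Prod.ext h1 ?_
  have h2 := (integral_eq_zero_iff_of_nonneg (fun _ => by positivity) (integrable_normSq a)).1 h
  refine (Lp.eq_zero_iff_ae_eq_zero).2 ?_
  filter_upwards [h2] with t ht
  simp only [Pi.zero_apply] at ht ⊢
  have : ‖a.2 t‖ ^ 2 = 0 := by nlinarith [sq_nonneg ‖a.1 t‖, sq_nonneg ‖a.2 t‖]
  simpa using this

/-- For trajectory differences the state is dominated by the `L_1` norm, hence by the `L_2` norm, so
the energy is equivalent to the squared `L_2` norm. If the latter vanishes, so does the difference.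
-/
theorem exists_energy_sub_le (hT : 0 < T)
    (hg : ∀ t x, HasFDerivAt (fun y => g (t, y)) (g' (t, x)) x)
    {c : C(Time T, Vec n)} {ξ₀ : ContCurve n m T} (h₀ : ξ₀.1 = c + integrated g ξ₀) :
    ∃ C₁ C₂ : ℝ, 0 ≤ C₁ ∧ 0 ≤ C₂ ∧ ∀ ξ : ContCurve n m T, ξ.1 = c + integrated g ξ →
      ‖pair (ξ - ξ₀)‖ ≤ 1 → energy hT (ξ - ξ₀) ≤ C₁ * normSqL2 (ξ - ξ₀) ∧
        ‖finalState hT (ξ - ξ₀)‖ ≤ C₂ * ‖pair (ξ - ξ₀)‖ ∧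
        (ξ ≠ ξ₀ → 0 < normSqL2 (ξ - ξ₀)) := by
  obtain ⟨L, hL, hLip⟩ := exists_norm_sub_fst_le hg h₀
  set V := (volume : Measure (Time T)).real univ
  have hV : 0 ≤ V := measureReal_nonneg
  refine ⟨1 + L ^ 2 * V, L * V, by positivity, by positivity, fun ξ hξ hd => ?_⟩
  have hx := hLip ξ hξ hd
  set ζ := ξ - ξ₀ with hζ
  have hI1 : ∫ t, ‖pair ζ t‖ ≤ V * ‖pair ζ‖ := integral_norm_le _
  have hI2 : (∫ t, ‖pair ζ t‖) ^ 2 ≤ V * normSqL2 ζ :=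
    (sq_integral_norm_le (pair ζ)).trans (by gcongr; exact integral_norm_sq_pair_le ζ)
  set I := ∫ t, ‖pair ζ t‖
  refine ⟨?_, ?_, fun hne => ?_⟩
  · have h1 : ‖finalState hT ζ‖ ^ 2 ≤ (L * I) ^ 2 := by
      gcongr; exact (norm_finalState_le hT ζ).trans hx
    have h2 : L ^ 2 * I ^ 2 ≤ L ^ 2 * (V * normSqL2 ζ) := by gcongr
    unfold energy
    linarith
  · have h2 : L * I ≤ L * (V * ‖pair ζ‖) := by gcongr
    rw [mul_assoc]
    exact ((norm_finalState_le hT ζ).trans hx).trans h2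
  · refine lt_of_le_of_ne (normSqL2_nonneg ζ) fun h => hne ?_
    rw [← h, mul_zero] at hI2
    have hI : I = 0 := pow_eq_zero_iff two_ne_zero |>.1 (le_antisymm hI2 (sq_nonneg I))
    have hz : ζ.1 = 0 := by
      rw [hI, mul_zero] at hx
      exact norm_le_zero_iff.1 hx
    exact sub_eq_zero.1 (eq_zero_of_normSqL2_eq_zero h.symm hz)

/-- The distance of a trajectory difference to the solutions of the linearized dynamics is of
higher order in `L_2`. -/
theorem exists_energy_correction_le (hT : 0 < T)
    (hg : ∀ t x, HasFDerivAt (fun y => g (t, y)) (g' (t, x)) x)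
    {c : C(Time T, Vec n)} {ξ₀ : ContCurve n m T} (h₀ : ξ₀.1 = c + integrated g ξ₀)
    (S : C(Time T, Vec n) →L[ℝ] ContCurve n m T) {κ : ℝ} (hκ : 0 < κ) :
    ∃ δ, 0 < δ ∧ ∀ ξ : ContCurve n m T, ξ.1 = c + integrated g ξ → ‖pair (ξ - ξ₀)‖ < δ →
      energy hT (S ((ξ - ξ₀).1 - integratedDeriv g' ξ₀ (ξ - ξ₀))) ≤
        κ ^ 2 * normSqL2 (ξ - ξ₀) := by
  set V := (volume : Measure (Time T)).real univ with hVdef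
  have hV : 0 ≤ V := measureReal_nonneg
  obtain ⟨s, hs, hs0⟩ : ∃ s, s = ‖S‖ ∧ 0 ≤ s := ⟨_, rfl, norm_nonneg S⟩
  -- `M` is the product of the constants from the energy bound, `S` and Cauchy–Schwarz. The
  -- tolerance `κ / (M + 1)` works because `M ≤ (M + 1) ^ 2`.
  obtain ⟨M, hM⟩ : ∃ M, M = (2 * V + 1) * s ^ 2 * V := ⟨_, rfl⟩
  have hM0 : 0 ≤ M := by rw [hM]; positivity
  have hM1 : M / (M + 1) ^ 2 ≤ 1 := by
    rw [div_le_one (by positivity)]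
    nlinarith
  obtain ⟨δ, hδ, hlin⟩ := exists_norm_linearization_le hg h₀
    (show 0 < κ / (M + 1) by positivity)
  refine ⟨δ, hδ, fun ξ hξ hd => ?_⟩
  have hw := hlin ξ hξ hd
  have hI : (∫ t, ‖pair (ξ - ξ₀) t‖) ^ 2 ≤ V * normSqL2 (ξ - ξ₀) :=
    (sq_integral_norm_le _).trans (by gcongr; exact integral_norm_sq_pair_le _)
  have hN := normSqL2_nonneg (ξ - ξ₀)
  have hS := S.le_opNorm ((ξ - ξ₀).1 - integratedDeriv g' ξ₀ (ξ - ξ₀))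
  have hE := energy_le hT (S ((ξ - ξ₀).1 - integratedDeriv g' ξ₀ (ξ - ξ₀)))
  rw [← hs] at hS
  rw [← hVdef] at hE
  generalize (∫ t, ‖pair (ξ - ξ₀) t‖) = I at *
  generalize normSqL2 (ξ - ξ₀) = N at *
  generalize ‖(ξ - ξ₀).1 - integratedDeriv g' ξ₀ (ξ - ξ₀)‖ = w at *
  refine hE.trans ?_
  have hd0 := norm_nonneg (S ((ξ - ξ₀).1 - integratedDeriv g' ξ₀ (ξ - ξ₀)))
  generalize ‖S ((ξ - ξ₀).1 - integratedDeriv g' ξ₀ (ξ - ξ₀))‖ = d at *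
  calc (2 * V + 1) * d ^ 2 ≤ (2 * V + 1) * (s * (κ / (M + 1) * I)) ^ 2 := by
        gcongr
        exact hS.trans (by gcongr)
    _ = (2 * V + 1) * s ^ 2 * (κ / (M + 1)) ^ 2 * I ^ 2 := by ring
    _ ≤ (2 * V + 1) * s ^ 2 * (κ / (M + 1)) ^ 2 * (V * N) := by gcongr
    _ = M / (M + 1) ^ 2 * (κ ^ 2 * N) := by
        rw [div_pow, show (2 * V + 1) * s ^ 2 * (κ ^ 2 / (M + 1) ^ 2) * (V * N) =
          (2 * V + 1) * s ^ 2 * V / (M + 1) ^ 2 * (κ ^ 2 * N) by ring, ← hM]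
    _ ≤ 1 * (κ ^ 2 * N) := by gcongr
    _ = κ ^ 2 * N := one_mul _

theorem energy_neg (hT : 0 < T) (d : ContCurve n m T) : energy hT (-d) = energy hT d := by
  have h : ∀ᵐ t : Time T, ‖(-d).1 t‖ ^ 2 + ‖(-d).2 t‖ ^ 2 = ‖d.1 t‖ ^ 2 + ‖d.2 t‖ ^ 2 := by
    filter_upwards [Lp.coeFn_neg d.2] with t ht
    rw [Prod.snd_neg, ht]
    simp
  simp only [energy, normSqL2, integral_congr_ae h, map_neg, norm_neg]

/-- The cross terms are kept in this order so that symmetry of `Q` is not needed. -/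
theorem bilin_sub_decomposition {X : Type*} [NormedAddCommGroup X] [NormedSpace ℝ X]
    (Q : X →L[ℝ] X →L[ℝ] ℝ) (x d : X) :
    Q x x = Q (x - d) (x - d) + Q (x - d) d + Q d x := by
  simp only [map_sub, sub_apply]
  ring

/-- Second-order sufficiency for a functional `J` on trajectories whose second derivative is bounded
and continuous with respect to the energy. -/
theorem exists_lt_of_coercive (hT : 0 < T)
    (hg : ∀ t x, HasFDerivAt (fun y => g (t, y)) (g' (t, x)) x)
    {c : C(Time T, Vec n)} {ξ₀ : ContCurve n m T} (h₀ : ξ₀.1 = c + integrated g ξ₀)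
    {J : ContCurve n m T → ℝ} {J' : ContCurve n m T → ContCurve n m T →L[ℝ] ℝ}
    {Q : ContCurve n m T → ContCurve n m T →L[ℝ] ContCurve n m T →L[ℝ] ℝ}
    (hJ : ∀ η, HasFDerivAt J (J' η) η) (hJ' : ∀ η, HasFDerivAt J' (Q η) η) (hcrit : J' ξ₀ = 0)
    {C : ℝ} (hC : 0 ≤ C) (hQ : ∀ a b, ∀ κ : ℝ, 0 < κ →
      |Q ξ₀ a b| ≤ C * (κ * energy hT a + κ⁻¹ * energy hT b))
    (hcont : ∀ ε : ℝ, 0 < ε → ∃ ρ, 0 < ρ ∧ ∀ η : ContCurve n m T, ‖pair (η - ξ₀)‖ < ρ →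
      ‖finalState hT (η - ξ₀)‖ < ρ → ∀ a, |Q η a a - Q ξ₀ a a| ≤ 2 * ε * energy hT a)
    (S : C(Time T, Vec n) →L[ℝ] ContCurve n m T)
    (hS : ∀ w, (S w).1 - integratedDeriv g' ξ₀ (S w) = w) {c₀ : ℝ} (hc₀ : 0 < c₀)
    (hcoer : ∀ γ : ContCurve n m T, γ.1 - integratedDeriv g' ξ₀ γ = 0 →
      c₀ * normSqL2 γ ≤ Q ξ₀ γ γ) :
    ∃ δ : ℝ, 0 < δ ∧ ∀ ξ : ContCurve n m T, ξ.1 = c + integrated g ξ →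
      ‖pair (ξ - ξ₀)‖ < δ → ξ ≠ ξ₀ → J ξ₀ < J ξ := by
  obtain ⟨C₁, C₂, hC₁, hC₂, hest⟩ := exists_energy_sub_le hT hg h₀
  obtain ⟨κ, hκ, harith⟩ := exists_pos_perturbation hc₀ hC hC₁
  obtain ⟨ρ, hρ, hclose⟩ := hcont κ hκ
  obtain ⟨δ₁, hδ₁, hcor⟩ := exists_energy_correction_le hT hg h₀ S hκ
  -- The bound `1` serves the Lipschitz estimate, `δ₁` the correction, and `ρ / (C₂ + 1)` keeps both
  -- the curve and its final state within `ρ`.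
  refine ⟨min (min 1 δ₁) (ρ / (C₂ + 1)), by positivity, fun ξ hξ hd hne => ?_⟩
  have hd1 := hd.trans_le ((min_le_left _ _).trans (min_le_left _ _))
  have hdρ : ‖pair (ξ - ξ₀)‖ * (C₂ + 1) < ρ := by
    rw [← lt_div_iff₀ (by positivity)]
    exact hd.trans_le (min_le_right _ _)
  obtain ⟨hNζ, hfin, hN⟩ := hest ξ hξ hd1.le
  have hNd := hcor ξ hξ (hd.trans_le ((min_le_left _ _).trans (min_le_right _ _)))
  obtain ⟨ζ, hζ⟩ : ∃ ζ, ζ = ξ - ξ₀ := ⟨_, rfl⟩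
  obtain ⟨d, hdef⟩ : ∃ d, d = S (ζ.1 - integratedDeriv g' ξ₀ ζ) := ⟨_, rfl⟩
  rw [← hζ, ← hdef] at hNd
  rw [← hζ] at hdρ hNζ hfin hN
  have hγt : (ζ - d).1 - integratedDeriv g' ξ₀ (ζ - d) = 0 := by
    rw [map_sub, Prod.fst_sub, sub_sub_sub_comm, hdef, hS, sub_self]
  have hNγ : energy hT (ζ - d) ≤ 2 * (energy hT ζ + energy hT d) := by
    have h1 := energy_add_le hT ζ (-d)
    rwa [energy_neg, ← sub_eq_add_neg] at h1
  have hnγ : normSqL2 ζ / 2 - energy hT d ≤ normSqL2 (ζ - d) := by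
    have h1 := normSqL2_add_le (ζ - d) d
    rw [sub_add_cancel] at h1
    have := normSqL2_le_energy hT d
    linarith
  -- In the cross term `Q d ζ` the small argument comes first, so the weight is inverted.
  have hpos := harith _ _ _ _ _ _ _ _ _ (hN hne) hNζ hNd hNγ hnγ (hcoer (ζ - d) hγt)
    (hQ (ζ - d) d κ hκ) (by
      have := hQ d ζ κ⁻¹ (inv_pos.2 hκ)
      rwa [inv_inv] at this) (bilin_sub_decomposition _ ζ d)
  have hρ1 : ‖pair ζ‖ < ρ := by
    have : 0 ≤ ‖pair ζ‖ * C₂ := by positivity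
    linarith
  have hρ2 : ‖finalState hT ζ‖ < ρ := by
    have := norm_nonneg (pair ζ)
    linarith
  -- The segment from `ξ₀` to `ξ` leaves the set of trajectories; this is harmless, since `J` is
  -- critical at `ξ₀` on the space of all curves.
  have htaylor := add_half_le_of_le_second_deriv hJ hJ' (x := ξ₀) (v := ζ) hcrit
    (c := Q ξ₀ ζ ζ - 2 * κ * energy hT ζ) (by
      intro s hs
      have hs1 : ‖s‖ ≤ 1 := by rw [Real.norm_of_nonneg hs.1]; exact hs.2
      have h1 := hclose (ξ₀ + s • ζ)
        (by
          rw [add_sub_cancel_left, map_smul, norm_smul]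
          exact (mul_le_of_le_one_left (norm_nonneg _) hs1).trans_lt hρ1)
        (by
          rw [add_sub_cancel_left, map_smul, norm_smul]
          exact (mul_le_of_le_one_left (norm_nonneg _) hs1).trans_lt hρ2) ζ
      have h2 := (abs_le.1 h1).1
      linarith)
  rw [hζ, add_sub_cancel, ← hζ] at htaylor
  linarith

/-- A trajectory at which a Lagrangian is critical, with second derivative coercive in `L_2` on the
solutions of the linearized dynamics, is a strict local minimizer of the cost in `L_∞`. -/
theorem exists_cost_lt_of_coercive (hT : 0 < T) {l : Time T → Vec n × Vec m → ℝ}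
    (hl : ∀ t x, lC (t, x) = l t x)
    (hl' : ∀ t x, HasFDerivAt (fun y => lC (t, y)) (l' (t, x)) x)
    (hl'' : ∀ t x, HasFDerivAt (fun y => l' (t, y)) (l'' (t, x)) x)
    (hφ : ∀ x, HasFDerivAt φ (φ' x) x) (hφ' : ∀ x, HasFDerivAt φ' (φ'' x) x)
    (hφ'' : Continuous φ'')
    (hg : ∀ t x, HasFDerivAt (fun y => g (t, y)) (g' (t, x)) x)
    (hg' : ∀ t x, HasFDerivAt (fun y => g' (t, y)) (g'' (t, x)) x)
    {c : C(Time T, Vec n)} {ξ₀ : ContCurve n m T} (h₀ : ξ₀.1 = c + integrated g ξ₀)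
    (lam : C(Time T, Vec n) →L[ℝ] ℝ) (hcrit : lagrangianDeriv hT l' φ' lam g' ξ₀ = 0)
    (S : C(Time T, Vec n) →L[ℝ] ContCurve n m T)
    (hS : ∀ w, (S w).1 - integratedDeriv g' ξ₀ (S w) = w) {c₀ : ℝ} (hc₀ : 0 < c₀)
    (hcoer : ∀ γ : ContCurve n m T, γ.1 - integratedDeriv g' ξ₀ γ = 0 → c₀ * normSqL2 γ ≤
      lagrangianForm hT lam (nemytskii l'' (pair ξ₀)) (nemytskii g'' (pair ξ₀))
        (φ'' (finalState hT ξ₀)) γ γ) :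
    ∃ δ : ℝ, 0 < δ ∧ ∀ ξ : ContCurve n m T, ξ.1 = c + integrated g ξ →
      ‖pair (ξ - ξ₀)‖ < δ → ξ ≠ ξ₀ → cost hT l φ ξ₀ < cost hT l φ ξ := by
  -- On trajectories the multiplier term vanishes, so the Lagrangian is the cost.
  have hz : ∀ η : ContCurve n m T, η.1 = c + integrated g η →
      lagrangian hT l φ lam g c η = cost hT l φ η := fun η hη => by
    rw [lagrangian, ← hη, sub_self, map_zero, sub_zero]
  obtain ⟨δ, hδ, h⟩ := exists_lt_of_coercive hT hg h₀
    (Q := fun η => lagrangianForm hT lam (nemytskii l'' (pair η)) (nemytskii g'' (pair η))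
      (φ'' (finalState hT η)))
    (hasFDerivAt_lagrangian hT hl hl' hφ hg lam c)
    (hasFDerivAt_lagrangianDeriv hT hl'' hφ' hg' lam) hcrit
    (by positivity) (fun a b κ hκ => abs_lagrangianForm_le hT lam _ _ _ a b hκ)
    (fun ε hε => exists_abs_lagrangianForm_sub_le hT lam hφ'' ξ₀ hε) S hS hc₀ hcoer
  refine ⟨δ, hδ, fun ξ hξ hd hne => ?_⟩
  rw [← hz ξ₀ h₀, ← hz ξ hξ]
  exact h ξ hξ hd hne

end Sufficiency

end TrajOpt

end

/-! ### The multiplier at `ξ₀` and the conclusion. -/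

theorem mainTheorem5 {n m : ℕ} {T : ℝ} (hT : 0 < T)
    (f : Vec n × Vec m → Vec n) (hf : ContDiff ℝ 2 f) (x₀ : Vec n)
    (K : Time T → Vec n →L[ℝ] Vec m) (hK : MemLp K ∞ volume)
    (l : Time T → Vec n × Vec m → ℝ) (hl : IsRunningCost l)
    (φ : Vec n → ℝ) (hφ : ContDiff ℝ 2 φ)
    (ξ₀ : ContCurve n m T) (hξ₀ : ξ₀ ∈ trajectories T f x₀)
    (hstat : ∀ ζ : Curve n m T,
      fderiv ℝ (reducedCost hT f x₀ K l φ) (toCurve ξ₀) ζ = 0)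
    (c₀ : ℝ) (hc₀ : 0 < c₀)
    (hSSC : ∀ ζ ∈ tangentSpace f x₀ K ξ₀,
      c₀ * normSqL2 ζ ≤
        fderiv ℝ (fderiv ℝ (reducedCost hT f x₀ K l φ)) (toCurve ξ₀) (toCurve ζ) (toCurve ζ)) :
    ∃ δ : ℝ, 0 < δ ∧ ∀ ξ ∈ trajectories T f x₀,
      ‖toCurve ξ - toCurve ξ₀‖ < δ → ξ ≠ ξ₀ →
        reducedCost hT f x₀ K l φ (toCurve ξ₀) < reducedCost hT f x₀ K l φ (toCurve ξ) := by
  obtain ⟨hf0, hf1, hfc1, hfc2⟩ := hasFDerivAt_fderiv_of_contDiff_two hf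
  obtain ⟨hφ0, hφ1, -, hφc2⟩ := hasFDerivAt_fderiv_of_contDiff_two hφ
  obtain ⟨lC, l', l'', hlC, hl', hl''⟩ := hl.exists_derivatives
  set g := autonomous T f hf.continuous
  set g' := autonomous T (fderiv ℝ f) hfc1
  set g'' := autonomous T (fderiv ℝ (fderiv ℝ f)) hfc2
  have hfg : ∀ p, g p = f p.2 := fun _ => rfl
  have hg : ∀ t x, HasFDerivAt (fun y => g (t, y)) (g' (t, x)) x := fun _ => hf0
  have hg' : ∀ t x, HasFDerivAt (fun y => g' (t, y)) (g'' (t, x)) x := fun _ => hf1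
  obtain ⟨S, hS⟩ := exists_rightInverse (hK.toLp K) g' ξ₀
  -- Forced by criticality: `DL(ξ₀)` must vanish on the range of `S`.
  set lam := costDeriv hT l' (fderiv ℝ φ) ξ₀ ∘L S
  set c := ContinuousMap.const (Time T) x₀
  have hP0 : projOp f x₀ K (toCurve ξ₀) = ξ₀ :=
    projOp_eq hfg hg hK (isFeedbackResponse_toCurve hξ₀)
  obtain ⟨hPc, hPev⟩ := contDiffAt_projOp hfg hg hK hξ₀
  have hh : HasFDerivAt (cost hT l φ) (costDeriv hT l' (fderiv ℝ φ) ξ₀)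
      (projOp f x₀ K (toCurve ξ₀)) := by
    rw [hP0]; exact hasFDerivAt_cost hT hlC hl' hφ0 ξ₀
  -- Differentiability is established here, so the zero in `hstat` is a genuine derivative and not
  -- the default value of `fderiv`.
  have hred : HasFDerivAt (reducedCost hT f x₀ K l φ) _ (toCurve ξ₀) :=
    hh.comp (toCurve ξ₀) (hPc.differentiableAt one_ne_zero).hasFDerivAt
  have hcost : ∀ γ : ContCurve n m T, γ.1 - integratedDeriv g' ξ₀ γ = 0 →
      costDeriv hT l' (fderiv ℝ φ) ξ₀ γ = 0 := fun γ hγ => by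
    have h1 := hstat (toCurve γ)
    rw [hred.fderiv, ContinuousLinearMap.comp_apply,
      fderiv_projOp_toCurve hfg hg hK hξ₀ hγ] at h1
    exact h1
  have hcrit : lagrangianDeriv hT l' (fderiv ℝ φ) lam g' ξ₀ = 0 := by
    refine ContinuousLinearMap.ext fun ζ => ?_
    let w := ζ.1 - integratedDeriv g' ξ₀ ζ
    -- `ζ - S w` lies in the kernel of the linearized constraint, and `lam w` is by definition the
    -- cost derivative at `S w`.
    have h1 := hcost (ζ - S w) (by
      rw [map_sub (integratedDeriv g' ξ₀) ζ (S w), Prod.fst_sub, sub_sub_sub_comm, hS]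
      exact sub_self w)
    rw [map_sub] at h1
    exact h1
  have hL : reducedCost hT f x₀ K l φ =ᶠ[nhds (toCurve ξ₀)]
      lagrangian hT l φ lam g c ∘ projOp f x₀ K := by
    filter_upwards [hPev] with ξ hξ
    have h1 := ((isFeedbackResponse_iff g hfg x₀ hK ξ _).1 hξ).1
    rw [Function.comp_apply, lagrangian, ← h1, sub_self, map_zero, sub_zero]
    rfl
  have hcoer : ∀ γ : ContCurve n m T, γ.1 - integratedDeriv g' ξ₀ γ = 0 → c₀ * normSqL2 γ ≤
      lagrangianForm hT lam (nemytskii l'' (pair ξ₀)) (nemytskii g'' (pair ξ₀))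
        (fderiv ℝ (fderiv ℝ φ) (finalState hT ξ₀)) γ γ := fun γ hγ => by
    have ht := fderiv_projOp_toCurve hfg hg hK hξ₀ hγ
    have h1 := hSSC γ ht
    rw [fderiv_fderiv_comp_of_critical
      (L'' := lagrangianForm hT lam (nemytskii l'' (pair ξ₀)) (nemytskii g'' (pair ξ₀))
        (fderiv ℝ (fderiv ℝ φ) (finalState hT ξ₀)))
      (hasFDerivAt_lagrangian hT hlC hl' hφ0 hg lam c)
      (by rw [hP0]; exact hasFDerivAt_lagrangianDeriv hT hl'' hφ1 hg' lam ξ₀)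
      (by rw [hP0]; exact hcrit) hPc hL, ht] at h1
    exact h1
  have hsol : ∀ ξ ∈ trajectories T f x₀, ξ.1 = c + integrated g ξ := fun ξ hξ =>
    (solvesDynamics_iff g hfg x₀ ξ).1 hξ
  obtain ⟨δ, hδ, hmin⟩ := exists_cost_lt_of_coercive hT hlC hl' hl'' hφ0 hφ1 hφc2 hg hg'
    (hsol ξ₀ hξ₀) lam hcrit S hS hc₀ hcoer
  -- Converts the `L_∞` norm on pairs of curves into the norm on curves of pairs.
  refine ⟨δ / (‖(joint : Curve n m T →L[ℝ] _)‖ + 1), by positivity, fun ξ hξ hd hne => ?_⟩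
  rw [reducedCost, reducedCost, hP0, projOp_eq hfg hg hK (isFeedbackResponse_toCurve hξ)]
  refine hmin ξ (hsol ξ hξ) ?_ hne
  rw [lt_div_iff₀ (by positivity)] at hd
  calc ‖pair (ξ - ξ₀)‖ = ‖joint (toCurve ξ - toCurve ξ₀)‖ := by rw [← map_sub]; rfl
    _ ≤ ‖(joint : Curve n m T →L[ℝ] _)‖ * ‖toCurve ξ - toCurve ξ₀‖ :=
        ContinuousLinearMap.le_opNorm _ _
    _ ≤ ‖toCurve ξ - toCurve ξ₀‖ * (‖(joint : Curve n m T →L[ℝ] _)‖ + 1) := by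
        have := norm_nonneg (toCurve ξ - toCurve ξ₀)
        linarith
    _ < δ := hd
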